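/- Let $\mathbf{mTT}$ and $\mathbf{emTT}$ be the intensional and the extensional level of Maietti's Minimalist Foundation. Both are dependent type theories with four kinds of types ($prop_s \subseteq prop \subseteq col$ and $prop_s \subseteq set \subseteq col$) and five forms of judgement: $\Gamma\ ctx$, $A\ type\ [\Gamma]$, $a \in A\ [\Gamma]$, $A = B\ type\ [\Gamma]$ and $a = b \in A\ [\Gamma]$, where $type$ is one of the four kinds. They share the sets $\mathsf{N_0}$, $\mathsf{N_1}$, $\Sigma$, $\Pi$, $+$, $\mathsf{List}$, the closure of collections under $\Sigma$, and the propositions $\bot,\wedge,\vee,\Rightarrow,\forall,\exists$. In $\mathbf{mTT}$ propositions carry proof-terms with their $\beta$-equalities, propositional equality is the type $\mathsf{Id}(A,a,b)$, which eliminates towards propositions $C(x,y)$ depending on $x,y \in A$ only, there is a universe $\mathsf{Prop_s}$ of small propositions with coding $\widehat{\varphi} \in \mathsf{Prop_s}$ and decoding $\mathsf{T}(c)\ prop_s$ such that $\mathsf{T}(\widehat{\varphi}) = \varphi$ and $\widehat{\mathsf{T}(c)} = c$, there are function collections $A \to \mathsf{Prop_s}$ for each set $A$, and equal terms may be substituted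 in types and terms, but congruence under binders is not assumed. In $\mathbf{emTT}$ propositions are proof-irrelevant with canonical proof-term $\mathsf{true}$, propositional equality $\mathsf{Eq}(A,a,b)$ reflects judgemental equality, all congruence rules and $\eta$-equalities hold, and there are effective quotients $A/R$ of sets by small equivalence relations, the power collection $\mathcal{P}(1)$ of the singleton, whose elements are the classes $[\varphi]$ of small propositions $\varphi$ up to equiprovability, and function collections $A \to \mathcal{P}(1)$ for each set $A$. One puts $\top :\equiv \bot \Rightarrow \bot$ and $\mathsf{Dc}(U) :\equiv \mathsf{Eq}(\mathcal{P}(1), U, [\top])$, a small proposition for each $U \in \mathcal{P}(1)$. The theory $\mathbf{emTT}+\mathsf{propext}$ extends $\mathbf{emTT}$ by the rules: if $\varphi$ and $\psi$ are propositions (respectively small propositions) and $\varphi \Leftrightarrow \psi\ \mathsf{true}$, then $\varphi = \psi\ prop$ (respectively $\varphi = \psi\ prop_s$). Let $(-)^{*}$ be the translation of the pre-syntax of $\mathbf{mTT}$ (pre-contexts, pre-types and pre-terms) into that of $\mathbf{emTT}$ that renames $\mathsf{Id}$ to $\mathsf{Eq}$, $\mathsf{Prop_s}$ to $\mathcal{P}(1)$,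 $\widehat{\varphi}$ to $[\varphi^{*}]$ and $\mathsf{T}(c)$ to $\mathsf{Dc}(c^{*})$, sends every term whose outermost symbol is a proof-term constructor (an introduction or elimination constructor of $\bot,\Rightarrow,\wedge,\vee,\forall,\exists$ or $\mathsf{Id}$) to $\mathsf{true}$, fixes variables, and commutes with all the other constructors. **Proposition.** The translation $(-)^{*}$ is an interpretation of $\mathbf{mTT}$ in $\mathbf{emTT}+\mathsf{propext}$, that is, it preserves derivability of judgements: 1. if $\mathbf{mTT} \vdash \Gamma\ ctx$, then $\mathbf{emTT}+\mathsf{propext} \vdash \Gamma^{*}\ ctx$; 2. if $\mathbf{mTT} \vdash A\ type\ [\Gamma]$, then $\mathbf{emTT}+\mathsf{propext} \vdash A^{*}\ type\ [\Gamma^{*}]$, for each of the four kinds; 3. if $\mathbf{mTT} \vdash a \in A\ [\Gamma]$, then $\mathbf{emTT}+\mathsf{propext} \vdash a^{*} \in A^{*}\ [\Gamma^{*}]$; 4. if $\mathbf{mTT} \vdash A = B\ type\ [\Gamma]$, then $\mathbf{emTT}+\mathsf{propext} \vdash A^{*} = B^{*}\ type\ [\Gamma^{*}]$, for each of the four kinds;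 5. if $\mathbf{mTT} \vdash a = b \in A\ [\Gamma]$, then $\mathbf{emTT}+\mathsf{propext} \vdash a^{*} = b^{*} \in A^{*}\ [\Gamma^{*}]$. -/

import Mathlib

namespace MF

/-- The two syntactic categories: pre-types (including pre-propositions) and pre-terms. -/
inductive Cat
  | ty
  | tm

/-- The four kinds of types: small propositions, propositions, sets, collections. -/
inductive Kind
  | props
  | prop
  | set
  | col

/-- The generating inclusions between kinds. -/
inductive Kind.Incl : Kind → Kind → Prop
  | props_prop : Incl .props .prop
  | props_set : Incl .props .set
  | prop_col : Incl .prop .col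
  | set_col : Incl .set .col

/-- Sets and collections, the non-logical kinds. -/
inductive Kind.IsMath : Kind → Prop
  | set : IsMath .set
  | col : IsMath .col

/-- Small propositions and propositions, the logical kinds. -/
inductive Kind.IsLogic : Kind → Prop
  | props : IsLogic .props
  | prop : IsLogic .prop

/-- `LogicOver k d`: quantifiers and equalities over domains of kind `d` are of kind `k`. -/
inductive Kind.LogicOver : Kind → Kind → Prop
  | small : LogicOver .props .set
  | large : LogicOver .prop .col

/-- The pre-types and pre-terms of `mTT` and of `emTT` in one pre-syntax, fully annotated, with de
Bruijn indices; propositions are among the pre-types. Bound variables: one in the family of `Sigma`,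
`Pi`, `all`, `ex` and where this family is repeated as an annotation, in the motives `M` and `L`, in
the bodies of `lam`, `impI`, `allI`, in the branches of `elPlus`, `elOr`, `elQ` and in the last
argument of `elId`; two in the branches of `elSigma`, `elEx`, in the argument `C` of `elId` and in
the relation `R` of `Quot`, `cls`, `elQ`; three (list, head, recursive value) in the branch of
`elList`. `hat` and `T` are coding and decoding for the universe `PropS` of small propositions,
`Quot A R` is `A/R` with classes `cls A R a`, `P1` is the power collection of the singleton with
elements `brack φ`, usually written `[φ]`, and `tru` is the canonical proof-term. -/
inductive Exp : Cat → Type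
  /- common to `mTT` and `emTT` -/
  | var (n : ℕ) : Exp .tm
  | N0 : Exp .ty
  | N1 : Exp .ty
  | Sigma (A B : Exp .ty) : Exp .ty
  | Pi (A B : Exp .ty) : Exp .ty
  | Plus (A B : Exp .ty) : Exp .ty
  | Lst (A : Exp .ty) : Exp .ty
  | bot : Exp .ty
  | and (φ ψ : Exp .ty) : Exp .ty
  | or (φ ψ : Exp .ty) : Exp .ty
  | imp (φ ψ : Exp .ty) : Exp .ty
  | all (A φ : Exp .ty) : Exp .ty
  | ex (A φ : Exp .ty) : Exp .ty
  | elN0 (M : Exp .ty) (a : Exp .tm) : Exp .tm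
  | star : Exp .tm
  | elN1 (M : Exp .ty) (t c : Exp .tm) : Exp .tm
  | pair (A B : Exp .ty) (a b : Exp .tm) : Exp .tm
  | elSigma (A B M : Exp .ty) (d m : Exp .tm) : Exp .tm
  | lam (A B : Exp .ty) (b : Exp .tm) : Exp .tm
  | app (A B : Exp .ty) (f a : Exp .tm) : Exp .tm
  | inl (A B : Exp .ty) (a : Exp .tm) : Exp .tm
  | inr (A B : Exp .ty) (b : Exp .tm) : Exp .tm
  | elPlus (A B M : Exp .ty) (w l r : Exp .tm) : Exp .tm
  | nil (A : Exp .ty) : Exp .tm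
  | cons (A : Exp .ty) (s a : Exp .tm) : Exp .tm
  | elList (A L : Exp .ty) (s a l : Exp .tm) : Exp .tm
  /- only in `mTT`: universe, intensional equality and proof-terms -/
  | PropS : Exp .ty
  | T (c : Exp .tm) : Exp .ty
  | Id (A : Exp .ty) (a b : Exp .tm) : Exp .ty
  | hat (φ : Exp .ty) : Exp .tm
  | elBot (φ : Exp .ty) (p : Exp .tm) : Exp .tm
  | impI (φ ψ : Exp .ty) (p : Exp .tm) : Exp .tm
  | impE (φ ψ : Exp .ty) (p q : Exp .tm) : Exp .tm
  | andI (φ ψ : Exp .ty) (p q : Exp .tm) : Exp .tm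
  | andE1 (φ ψ : Exp .ty) (p : Exp .tm) : Exp .tm
  | andE2 (φ ψ : Exp .ty) (p : Exp .tm) : Exp .tm
  | orI1 (φ ψ : Exp .ty) (p : Exp .tm) : Exp .tm
  | orI2 (φ ψ : Exp .ty) (p : Exp .tm) : Exp .tm
  | elOr (φ ψ χ : Exp .ty) (p l r : Exp .tm) : Exp .tm
  | allI (A φ : Exp .ty) (p : Exp .tm) : Exp .tm
  | allE (A φ : Exp .ty) (p a : Exp .tm) : Exp .tm
  | exI (A φ : Exp .ty) (a p : Exp .tm) : Exp .tm
  | elEx (A φ χ : Exp .ty) (p m : Exp .tm) : Exp .tm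
  | idI (A : Exp .ty) (a : Exp .tm) : Exp .tm
  | elId (A C : Exp .ty) (a b p c : Exp .tm) : Exp .tm
  /- only in `emTT`: quotients, power collection of the singleton, equality, canonical proof -/
  | Quot (A R : Exp .ty) : Exp .ty
  | P1 : Exp .ty
  | Eq (A : Exp .ty) (a b : Exp .tm) : Exp .ty
  | cls (A R : Exp .ty) (a : Exp .tm) : Exp .tm
  | elQ (A R L : Exp .ty) (l p : Exp .tm) : Exp .tm
  | brack (φ : Exp .ty) : Exp .tm
  | tru : Exp .tm

namespace Exp

/-- Lifting of a renaming under one binder. -/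
def upr (ξ : ℕ → ℕ) : ℕ → ℕ
  | 0 => 0
  | n + 1 => ξ n + 1

/-- Renaming of the free variables. -/
def rename : (ℕ → ℕ) → {c : Cat} → Exp c → Exp c
  | ξ, _, .var n => .var (ξ n)
  | _, _, .N0 => .N0
  | _, _, .N1 => .N1
  | ξ, _, .Sigma A B => .Sigma (rename ξ A) (rename (upr ξ) B)
  | ξ, _, .Pi A B => .Pi (rename ξ A) (rename (upr ξ) B)
  | ξ, _, .Plus A B => .Plus (rename ξ A) (rename ξ B)
  | ξ, _, .Lst A => .Lst (rename ξ A)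
  | _, _, .bot => .bot
  | ξ, _, .and φ ψ => .and (rename ξ φ) (rename ξ ψ)
  | ξ, _, .or φ ψ => .or (rename ξ φ) (rename ξ ψ)
  | ξ, _, .imp φ ψ => .imp (rename ξ φ) (rename ξ ψ)
  | ξ, _, .all A φ => .all (rename ξ A) (rename (upr ξ) φ)
  | ξ, _, .ex A φ => .ex (rename ξ A) (rename (upr ξ) φ)
  | _, _, .PropS => .PropS
  | ξ, _, .T c => .T (rename ξ c)
  | ξ, _, .Id A a b => .Id (rename ξ A) (rename ξ a) (rename ξ b)
  | ξ, _, .Quot A R => .Quot (rename ξ A) (rename (upr (upr ξ)) R)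
  | _, _, .P1 => .P1
  | ξ, _, .Eq A a b => .Eq (rename ξ A) (rename ξ a) (rename ξ b)
  | ξ, _, .elN0 M a => .elN0 (rename (upr ξ) M) (rename ξ a)
  | _, _, .star => .star
  | ξ, _, .elN1 M t c => .elN1 (rename (upr ξ) M) (rename ξ t) (rename ξ c)
  | ξ, _, .pair A B a b => .pair (rename ξ A) (rename (upr ξ) B) (rename ξ a) (rename ξ b)
  | ξ, _, .elSigma A B M d m =>
    .elSigma (rename ξ A) (rename (upr ξ) B) (rename (upr ξ) M)
      (rename ξ d) (rename (upr (upr ξ)) m)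
  | ξ, _, .lam A B b => .lam (rename ξ A) (rename (upr ξ) B) (rename (upr ξ) b)
  | ξ, _, .app A B f a => .app (rename ξ A) (rename (upr ξ) B) (rename ξ f) (rename ξ a)
  | ξ, _, .inl A B a => .inl (rename ξ A) (rename ξ B) (rename ξ a)
  | ξ, _, .inr A B b => .inr (rename ξ A) (rename ξ B) (rename ξ b)
  | ξ, _, .elPlus A B M w l r =>
    .elPlus (rename ξ A) (rename ξ B) (rename (upr ξ) M)
      (rename ξ w) (rename (upr ξ) l) (rename (upr ξ) r)
  | ξ, _, .nil A => .nil (rename ξ A)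
  | ξ, _, .cons A s a => .cons (rename ξ A) (rename ξ s) (rename ξ a)
  | ξ, _, .elList A L s a l =>
    .elList (rename ξ A) (rename (upr ξ) L) (rename ξ s)
      (rename ξ a) (rename (upr (upr (upr ξ))) l)
  | ξ, _, .hat φ => .hat (rename ξ φ)
  | ξ, _, .elBot φ p => .elBot (rename ξ φ) (rename ξ p)
  | ξ, _, .impI φ ψ p => .impI (rename ξ φ) (rename ξ ψ) (rename (upr ξ) p)
  | ξ, _, .impE φ ψ p q => .impE (rename ξ φ) (rename ξ ψ) (rename ξ p) (rename ξ q)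
  | ξ, _, .andI φ ψ p q => .andI (rename ξ φ) (rename ξ ψ) (rename ξ p) (rename ξ q)
  | ξ, _, .andE1 φ ψ p => .andE1 (rename ξ φ) (rename ξ ψ) (rename ξ p)
  | ξ, _, .andE2 φ ψ p => .andE2 (rename ξ φ) (rename ξ ψ) (rename ξ p)
  | ξ, _, .orI1 φ ψ p => .orI1 (rename ξ φ) (rename ξ ψ) (rename ξ p)
  | ξ, _, .orI2 φ ψ p => .orI2 (rename ξ φ) (rename ξ ψ) (rename ξ p)
  | ξ, _, .elOr φ ψ χ p l r =>
    .elOr (rename ξ φ) (rename ξ ψ) (rename ξ χ)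
      (rename ξ p) (rename (upr ξ) l) (rename (upr ξ) r)
  | ξ, _, .allI A φ p => .allI (rename ξ A) (rename (upr ξ) φ) (rename (upr ξ) p)
  | ξ, _, .allE A φ p a => .allE (rename ξ A) (rename (upr ξ) φ) (rename ξ p) (rename ξ a)
  | ξ, _, .exI A φ a p => .exI (rename ξ A) (rename (upr ξ) φ) (rename ξ a) (rename ξ p)
  | ξ, _, .elEx A φ χ p m =>
    .elEx (rename ξ A) (rename (upr ξ) φ) (rename ξ χ) (rename ξ p) (rename (upr (upr ξ)) m)
  | ξ, _, .idI A a => .idI (rename ξ A) (rename ξ a)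
  | ξ, _, .elId A C a b p c =>
    .elId (rename ξ A) (rename (upr (upr ξ)) C) (rename ξ a)
      (rename ξ b) (rename ξ p) (rename (upr ξ) c)
  | ξ, _, .cls A R a => .cls (rename ξ A) (rename (upr (upr ξ)) R) (rename ξ a)
  | ξ, _, .elQ A R L l p =>
    .elQ (rename ξ A) (rename (upr (upr ξ)) R) (rename (upr ξ) L) (rename (upr ξ) l) (rename ξ p)
  | ξ, _, .brack φ => .brack (rename ξ φ)
  | _, _, .tru => .tru

/-- Weakening by `k` variables. -/
def wk (k : ℕ) {c : Cat} (e : Exp c) : Exp c := e.rename (fun n => n + k)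

/-- The substitution sending the last variable to `a` and the others according to `σ`. -/
def scons (a : Exp .tm) (σ : ℕ → Exp .tm) : ℕ → Exp .tm
  | 0 => a
  | n + 1 => σ n

/-- The substitution that weakens by `k` variables; `sh 0` is the identity. -/
def sh (k : ℕ) : ℕ → Exp .tm := fun n => .var (n + k)

/-- Lifting of a substitution under one binder. -/
def ups (σ : ℕ → Exp .tm) : ℕ → Exp .tm
  | 0 => .var 0
  | n + 1 => (σ n).wk 1

/-- Simultaneous capture-avoiding substitution. -/
def subst : (ℕ → Exp .tm) → {c : Cat} → Exp c → Exp c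
  | σ, _, .var n => σ n
  | _, _, .N0 => .N0
  | _, _, .N1 => .N1
  | σ, _, .Sigma A B => .Sigma (subst σ A) (subst (ups σ) B)
  | σ, _, .Pi A B => .Pi (subst σ A) (subst (ups σ) B)
  | σ, _, .Plus A B => .Plus (subst σ A) (subst σ B)
  | σ, _, .Lst A => .Lst (subst σ A)
  | _, _, .bot => .bot
  | σ, _, .and φ ψ => .and (subst σ φ) (subst σ ψ)
  | σ, _, .or φ ψ => .or (subst σ φ) (subst σ ψ)
  | σ, _, .imp φ ψ => .imp (subst σ φ) (subst σ ψ)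
  | σ, _, .all A φ => .all (subst σ A) (subst (ups σ) φ)
  | σ, _, .ex A φ => .ex (subst σ A) (subst (ups σ) φ)
  | _, _, .PropS => .PropS
  | σ, _, .T c => .T (subst σ c)
  | σ, _, .Id A a b => .Id (subst σ A) (subst σ a) (subst σ b)
  | σ, _, .Quot A R => .Quot (subst σ A) (subst (ups (ups σ)) R)
  | _, _, .P1 => .P1
  | σ, _, .Eq A a b => .Eq (subst σ A) (subst σ a) (subst σ b)
  | σ, _, .elN0 M a => .elN0 (subst (ups σ) M) (subst σ a)
  | _, _, .star => .star
  | σ, _, .elN1 M t c => .elN1 (subst (ups σ) M) (subst σ t) (subst σ c)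
  | σ, _, .pair A B a b => .pair (subst σ A) (subst (ups σ) B) (subst σ a) (subst σ b)
  | σ, _, .elSigma A B M d m =>
    .elSigma (subst σ A) (subst (ups σ) B) (subst (ups σ) M) (subst σ d) (subst (ups (ups σ)) m)
  | σ, _, .lam A B b => .lam (subst σ A) (subst (ups σ) B) (subst (ups σ) b)
  | σ, _, .app A B f a => .app (subst σ A) (subst (ups σ) B) (subst σ f) (subst σ a)
  | σ, _, .inl A B a => .inl (subst σ A) (subst σ B) (subst σ a)
  | σ, _, .inr A B b => .inr (subst σ A) (subst σ B) (subst σ b)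
  | σ, _, .elPlus A B M w l r =>
    .elPlus (subst σ A) (subst σ B) (subst (ups σ) M)
      (subst σ w) (subst (ups σ) l) (subst (ups σ) r)
  | σ, _, .nil A => .nil (subst σ A)
  | σ, _, .cons A s a => .cons (subst σ A) (subst σ s) (subst σ a)
  | σ, _, .elList A L s a l =>
    .elList (subst σ A) (subst (ups σ) L) (subst σ s) (subst σ a) (subst (ups (ups (ups σ))) l)
  | σ, _, .hat φ => .hat (subst σ φ)
  | σ, _, .elBot φ p => .elBot (subst σ φ) (subst σ p)
  | σ, _, .impI φ ψ p => .impI (subst σ φ) (subst σ ψ) (subst (ups σ) p)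
  | σ, _, .impE φ ψ p q => .impE (subst σ φ) (subst σ ψ) (subst σ p) (subst σ q)
  | σ, _, .andI φ ψ p q => .andI (subst σ φ) (subst σ ψ) (subst σ p) (subst σ q)
  | σ, _, .andE1 φ ψ p => .andE1 (subst σ φ) (subst σ ψ) (subst σ p)
  | σ, _, .andE2 φ ψ p => .andE2 (subst σ φ) (subst σ ψ) (subst σ p)
  | σ, _, .orI1 φ ψ p => .orI1 (subst σ φ) (subst σ ψ) (subst σ p)
  | σ, _, .orI2 φ ψ p => .orI2 (subst σ φ) (subst σ ψ) (subst σ p)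
  | σ, _, .elOr φ ψ χ p l r =>
    .elOr (subst σ φ) (subst σ ψ) (subst σ χ) (subst σ p) (subst (ups σ) l) (subst (ups σ) r)
  | σ, _, .allI A φ p => .allI (subst σ A) (subst (ups σ) φ) (subst (ups σ) p)
  | σ, _, .allE A φ p a => .allE (subst σ A) (subst (ups σ) φ) (subst σ p) (subst σ a)
  | σ, _, .exI A φ a p => .exI (subst σ A) (subst (ups σ) φ) (subst σ a) (subst σ p)
  | σ, _, .elEx A φ χ p m =>
    .elEx (subst σ A) (subst (ups σ) φ) (subst σ χ) (subst σ p) (subst (ups (ups σ)) m)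
  | σ, _, .idI A a => .idI (subst σ A) (subst σ a)
  | σ, _, .elId A C a b p c =>
    .elId (subst σ A) (subst (ups (ups σ)) C) (subst σ a)
      (subst σ b) (subst σ p) (subst (ups σ) c)
  | σ, _, .cls A R a => .cls (subst σ A) (subst (ups (ups σ)) R) (subst σ a)
  | σ, _, .elQ A R L l p =>
    .elQ (subst σ A) (subst (ups (ups σ)) R) (subst (ups σ) L) (subst (ups σ) l) (subst σ p)
  | σ, _, .brack φ => .brack (subst σ φ)
  | _, _, .tru => .tru

/-- `e(a)` for `e` with one distinguished variable. -/
def inst {c : Cat} (e : Exp c) (a : Exp .tm) : Exp c := e.subst (scons a (sh 0))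

/-- `e(a, b)` for `e` with two distinguished variables. -/
def inst2 {c : Cat} (e : Exp c) (a b : Exp .tm) : Exp c := e.subst (scons b (scons a (sh 0)))

/-- `e(a, b, d)` for `e` with three distinguished variables. -/
def inst3 {c : Cat} (e : Exp c) (a b d : Exp .tm) : Exp c :=
  e.subst (scons d (scons b (scons a (sh 0))))

/-- `e(a)` in a context extended by `k` variables; `a` lives in the extended context. -/
def instW (k : ℕ) {c : Cat} (e : Exp c) (a : Exp .tm) : Exp c := e.subst (scons a (sh k))

/-- `e(a, b)` in a context extended by `k` variables. -/
def instW2 (k : ℕ) {c : Cat} (e : Exp c) (a b : Exp .tm) : Exp c :=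
  e.subst (scons b (scons a (sh k)))

/-- Weakening by `k` variables below one bound variable. -/
def wkB (k : ℕ) {c : Cat} (e : Exp c) : Exp c := e.rename (upr (fun n => n + k))

/-- Weakening by `k` variables below two bound variables. -/
def wkB2 (k : ℕ) {c : Cat} (e : Exp c) : Exp c := e.rename (upr (upr (fun n => n + k)))

/-- Negation. -/
def neg (φ : Exp .ty) : Exp .ty := .imp φ .bot

/-- The true constant. -/
def top : Exp .ty := neg .bot

/-- Logical equivalence. -/
def iff (φ ψ : Exp .ty) : Exp .ty := .and (.imp φ ψ) (.imp ψ φ)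

/-- The decoding of an element of the power collection of the singleton, in `emTT`. -/
def Dc (U : Exp .tm) : Exp .ty := .Eq .P1 U (.brack top)

end Exp

/-- Contexts, the last declared variable first. -/
abbrev Ctx := List (Exp .ty)

/-- What a judgement asserts in its context: that the context is well formed, that `A` is a type of
kind `k`, that `A = B` as types of kind `k`, that `a ∈ A`, that `a = b ∈ A`. -/
inductive Stmt
  | ctx : Stmt
  | ty (k : Kind) (A : Exp .ty) : Stmt
  | tyEq (k : Kind) (A B : Exp .ty) : Stmt
  | tm (a : Exp .tm) (A : Exp .ty) : Stmt
  | tmEq (a b : Exp .tm) (A : Exp .ty) : Stmt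

/-- Simultaneous substitution in the body of a judgement. -/
def Stmt.subst (σ : ℕ → Exp .tm) : Stmt → Stmt
  | .ctx => .ctx
  | .ty k A => .ty k (A.subst σ)
  | .tyEq k A B => .tyEq k (A.subst σ) (B.subst σ)
  | .tm a A => .tm (a.subst σ) (A.subst σ)
  | .tmEq a b A => .tmEq (a.subst σ) (b.subst σ) (A.subst σ)

/-- The theories: `mTT`, `emTT`, and `emTT` with propositional extensionality. -/
inductive Theory
  | mTT
  | emTT
  | emTTpropext

/-- The extensional theories, `emTT` and its extension. -/
inductive Theory.IsExt : Theory → Prop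
  | emTT : IsExt .emTT
  | emTTpropext : IsExt .emTTpropext

/-- Derivability of judgements in the theory `𝒯`. Besides those of the universe, `mTT` has no
congruence rules: equal terms may only be substituted for variables, by `subT` and `sub`. -/
inductive Der (𝒯 : Theory) : Ctx → Stmt → Prop
  /- common to all theories: contexts and variables -/
  | ctx_nil : Der 𝒯 [] .ctx
  | ctx_cons {Γ : Ctx} {A : Exp .ty} : Der 𝒯 Γ (.ty .col A) → Der 𝒯 (A :: Γ) .ctx
  | var {Γ : Ctx} {i : ℕ} {A : Exp .ty} :
      Der 𝒯 Γ .ctx → Γ[i]? = some A → Der 𝒯 Γ (.tm (.var i) (A.wk (i + 1)))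
  /- substitution and weakening: `σ` is a telescopic substitution from `Δ` to `Γ` -/
  | subst {Γ Δ : Ctx} {S : Stmt} {σ : ℕ → Exp .tm} :
      Der 𝒯 Γ S → Der 𝒯 Δ .ctx →
      (∀ i A, Γ[i]? = some A → Der 𝒯 Δ (.tm (σ i) ((A.wk (i + 1)).subst σ))) →
      Der 𝒯 Δ (S.subst σ)
  /- substitution of equal terms in types and in terms -/
  | subT {Γ Δ : Ctx} {k : Kind} {C : Exp .ty} {σ τ : ℕ → Exp .tm} :
      Der 𝒯 Γ (.ty k C) → Der 𝒯 Δ .ctx →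
      (∀ i A, Γ[i]? = some A → Der 𝒯 Δ (.tmEq (σ i) (τ i) ((A.wk (i + 1)).subst σ))) →
      Der 𝒯 Δ (.tyEq k (C.subst σ) (C.subst τ))
  | sub {Γ Δ : Ctx} {c : Exp .tm} {C : Exp .ty} {σ τ : ℕ → Exp .tm} :
      Der 𝒯 Γ (.tm c C) → Der 𝒯 Δ .ctx →
      (∀ i A, Γ[i]? = some A → Der 𝒯 Δ (.tmEq (σ i) (τ i) ((A.wk (i + 1)).subst σ))) →
      Der 𝒯 Δ (.tmEq (c.subst σ) (c.subst τ) (C.subst σ))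
  /- inclusions of kinds -/
  | incl {Γ : Ctx} {k k' : Kind} {A : Exp .ty} :
      k.Incl k' → Der 𝒯 Γ (.ty k A) → Der 𝒯 Γ (.ty k' A)
  | inclEq {Γ : Ctx} {k k' : Kind} {A B : Exp .ty} :
      k.Incl k' → Der 𝒯 Γ (.tyEq k A B) → Der 𝒯 Γ (.tyEq k' A B)
  /- equality is an equivalence relation; conversion -/
  | refT {Γ : Ctx} {k : Kind} {A : Exp .ty} : Der 𝒯 Γ (.ty k A) → Der 𝒯 Γ (.tyEq k A A)
  | symT {Γ : Ctx} {k : Kind} {A B : Exp .ty} :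
      Der 𝒯 Γ (.tyEq k A B) → Der 𝒯 Γ (.tyEq k B A)
  | traT {Γ : Ctx} {k : Kind} {A B C : Exp .ty} :
      Der 𝒯 Γ (.tyEq k A B) → Der 𝒯 Γ (.tyEq k B C) → Der 𝒯 Γ (.tyEq k A C)
  | ref {Γ : Ctx} {a : Exp .tm} {A : Exp .ty} : Der 𝒯 Γ (.tm a A) → Der 𝒯 Γ (.tmEq a a A)
  | sym {Γ : Ctx} {a b : Exp .tm} {A : Exp .ty} :
      Der 𝒯 Γ (.tmEq a b A) → Der 𝒯 Γ (.tmEq b a A)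
  | tra {Γ : Ctx} {a b c : Exp .tm} {A : Exp .ty} :
      Der 𝒯 Γ (.tmEq a b A) → Der 𝒯 Γ (.tmEq b c A) → Der 𝒯 Γ (.tmEq a c A)
  | conv {Γ : Ctx} {a : Exp .tm} {A B : Exp .ty} :
      Der 𝒯 Γ (.tm a A) → Der 𝒯 Γ (.tyEq .col A B) → Der 𝒯 Γ (.tm a B)
  | convEq {Γ : Ctx} {a b : Exp .tm} {A B : Exp .ty} :
      Der 𝒯 Γ (.tmEq a b A) → Der 𝒯 Γ (.tyEq .col A B) → Der 𝒯 Γ (.tmEq a b B)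
  /- empty set -/
  | N0_form {Γ : Ctx} :
      Der 𝒯 Γ .ctx → Der 𝒯 Γ (.ty .set .N0)
  | N0_elim {Γ : Ctx} {M : Exp .ty} {a : Exp .tm} :
      Der 𝒯 (.N0 :: Γ) (.ty .col M) → Der 𝒯 Γ (.tm a .N0) → Der 𝒯 Γ (.tm (.elN0 M a) (M.inst a))
  /- singleton set -/
  | N1_form {Γ : Ctx} :
      Der 𝒯 Γ .ctx → Der 𝒯 Γ (.ty .set .N1)
  | N1_intro {Γ : Ctx} :
      Der 𝒯 Γ .ctx → Der 𝒯 Γ (.tm .star .N1)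
  | N1_elim {Γ : Ctx} {M : Exp .ty} {t c : Exp .tm} :
      Der 𝒯 (.N1 :: Γ) (.ty .col M) → Der 𝒯 Γ (.tm t .N1) → Der 𝒯 Γ (.tm c (M.inst .star)) →
      Der 𝒯 Γ (.tm (.elN1 M t c) (M.inst t))
  | N1_beta {Γ : Ctx} {M : Exp .ty} {c : Exp .tm} :
      Der 𝒯 (.N1 :: Γ) (.ty .col M) → Der 𝒯 Γ (.tm c (M.inst .star)) →
      Der 𝒯 Γ (.tmEq (.elN1 M .star c) c (M.inst .star))
  /- strong indexed sums, of sets and of collections -/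
  | Sigma_form {Γ : Ctx} {k : Kind} {A B : Exp .ty} :
      k.IsMath → Der 𝒯 Γ (.ty k A) → Der 𝒯 (A :: Γ) (.ty k B) → Der 𝒯 Γ (.ty k (.Sigma A B))
  | Sigma_intro {Γ : Ctx} {A B : Exp .ty} {a b : Exp .tm} :
      Der 𝒯 Γ (.ty .col A) → Der 𝒯 (A :: Γ) (.ty .col B) → Der 𝒯 Γ (.tm a A) →
      Der 𝒯 Γ (.tm b (B.inst a)) → Der 𝒯 Γ (.tm (.pair A B a b) (.Sigma A B))
  | Sigma_elim {Γ : Ctx} {A B M : Exp .ty} {d m : Exp .tm} :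
      Der 𝒯 Γ (.ty .col A) → Der 𝒯 (A :: Γ) (.ty .col B) → Der 𝒯 (.Sigma A B :: Γ) (.ty .col M) →
      Der 𝒯 Γ (.tm d (.Sigma A B)) →
      Der 𝒯 (B :: A :: Γ) (.tm m (M.instW 2 (.pair (A.wk 2) (B.wkB 2) (.var 1) (.var 0)))) →
      Der 𝒯 Γ (.tm (.elSigma A B M d m) (M.inst d))
  | Sigma_beta {Γ : Ctx} {A B M : Exp .ty} {a b m : Exp .tm} :
      Der 𝒯 Γ (.ty .col A) → Der 𝒯 (A :: Γ) (.ty .col B) → Der 𝒯 (.Sigma A B :: Γ) (.ty .col M) →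
      Der 𝒯 Γ (.tm a A) → Der 𝒯 Γ (.tm b (B.inst a)) →
      Der 𝒯 (B :: A :: Γ) (.tm m (M.instW 2 (.pair (A.wk 2) (B.wkB 2) (.var 1) (.var 0)))) →
      Der 𝒯 Γ (.tmEq (.elSigma A B M (.pair A B a b) m) (m.inst2 a b) (M.inst (.pair A B a b)))
  /- dependent products of sets -/
  | Pi_form {Γ : Ctx} {A B : Exp .ty} :
      Der 𝒯 Γ (.ty .set A) → Der 𝒯 (A :: Γ) (.ty .set B) → Der 𝒯 Γ (.ty .set (.Pi A B))
  | Pi_intro {Γ : Ctx} {A B : Exp .ty} {b : Exp .tm} :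
      Der 𝒯 Γ (.ty .col A) → Der 𝒯 (A :: Γ) (.ty .col B) → Der 𝒯 Γ (.ty .col (.Pi A B)) →
      Der 𝒯 (A :: Γ) (.tm b B) → Der 𝒯 Γ (.tm (.lam A B b) (.Pi A B))
  | Pi_elim {Γ : Ctx} {A B : Exp .ty} {f a : Exp .tm} :
      Der 𝒯 Γ (.ty .col A) → Der 𝒯 (A :: Γ) (.ty .col B) → Der 𝒯 Γ (.ty .col (.Pi A B)) →
      Der 𝒯 Γ (.tm f (.Pi A B)) → Der 𝒯 Γ (.tm a A) → Der 𝒯 Γ (.tm (.app A B f a) (B.inst a))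
  | Pi_beta {Γ : Ctx} {A B : Exp .ty} {b a : Exp .tm} :
      Der 𝒯 Γ (.ty .col A) → Der 𝒯 (A :: Γ) (.ty .col B) → Der 𝒯 Γ (.ty .col (.Pi A B)) →
      Der 𝒯 (A :: Γ) (.tm b B) → Der 𝒯 Γ (.tm a A) →
      Der 𝒯 Γ (.tmEq (.app A B (.lam A B b) a) (b.inst a) (B.inst a))
  /- disjoint sums of sets -/
  | Plus_form {Γ : Ctx} {A B : Exp .ty} :
      Der 𝒯 Γ (.ty .set A) → Der 𝒯 Γ (.ty .set B) → Der 𝒯 Γ (.ty .set (.Plus A B))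
  | Plus_intro1 {Γ : Ctx} {A B : Exp .ty} {a : Exp .tm} :
      Der 𝒯 Γ (.ty .set A) → Der 𝒯 Γ (.ty .set B) → Der 𝒯 Γ (.tm a A) →
      Der 𝒯 Γ (.tm (.inl A B a) (.Plus A B))
  | Plus_intro2 {Γ : Ctx} {A B : Exp .ty} {b : Exp .tm} :
      Der 𝒯 Γ (.ty .set A) → Der 𝒯 Γ (.ty .set B) → Der 𝒯 Γ (.tm b B) →
      Der 𝒯 Γ (.tm (.inr A B b) (.Plus A B))
  | Plus_elim {Γ : Ctx} {A B M : Exp .ty} {w l r : Exp .tm} :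
      Der 𝒯 Γ (.ty .set A) → Der 𝒯 Γ (.ty .set B) → Der 𝒯 (.Plus A B :: Γ) (.ty .col M) →
      Der 𝒯 Γ (.tm w (.Plus A B)) →
      Der 𝒯 (A :: Γ) (.tm l (M.instW 1 (.inl (A.wk 1) (B.wk 1) (.var 0)))) →
      Der 𝒯 (B :: Γ) (.tm r (M.instW 1 (.inr (A.wk 1) (B.wk 1) (.var 0)))) →
      Der 𝒯 Γ (.tm (.elPlus A B M w l r) (M.inst w))
  | Plus_beta1 {Γ : Ctx} {A B M : Exp .ty} {a l r : Exp .tm} :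
      Der 𝒯 Γ (.ty .set A) → Der 𝒯 Γ (.ty .set B) → Der 𝒯 (.Plus A B :: Γ) (.ty .col M) →
      Der 𝒯 Γ (.tm a A) → Der 𝒯 (A :: Γ) (.tm l (M.instW 1 (.inl (A.wk 1) (B.wk 1) (.var 0)))) →
      Der 𝒯 (B :: Γ) (.tm r (M.instW 1 (.inr (A.wk 1) (B.wk 1) (.var 0)))) →
      Der 𝒯 Γ (.tmEq (.elPlus A B M (.inl A B a) l r) (l.inst a) (M.inst (.inl A B a)))
  | Plus_beta2 {Γ : Ctx} {A B M : Exp .ty} {b l r : Exp .tm} :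
      Der 𝒯 Γ (.ty .set A) → Der 𝒯 Γ (.ty .set B) → Der 𝒯 (.Plus A B :: Γ) (.ty .col M) →
      Der 𝒯 Γ (.tm b B) → Der 𝒯 (A :: Γ) (.tm l (M.instW 1 (.inl (A.wk 1) (B.wk 1) (.var 0)))) →
      Der 𝒯 (B :: Γ) (.tm r (M.instW 1 (.inr (A.wk 1) (B.wk 1) (.var 0)))) →
      Der 𝒯 Γ (.tmEq (.elPlus A B M (.inr A B b) l r) (r.inst b) (M.inst (.inr A B b)))
  /- lists -/
  | Lst_form {Γ : Ctx} {A : Exp .ty} :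
      Der 𝒯 Γ (.ty .set A) → Der 𝒯 Γ (.ty .set (.Lst A))
  | Lst_nil {Γ : Ctx} {A : Exp .ty} :
      Der 𝒯 Γ (.ty .set A) → Der 𝒯 Γ (.tm (.nil A) (.Lst A))
  | Lst_cons {Γ : Ctx} {A : Exp .ty} {s a : Exp .tm} :
      Der 𝒯 Γ (.ty .set A) → Der 𝒯 Γ (.tm s (.Lst A)) → Der 𝒯 Γ (.tm a A) →
      Der 𝒯 Γ (.tm (.cons A s a) (.Lst A))
  | Lst_elim {Γ : Ctx} {A L : Exp .ty} {s a l : Exp .tm} :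
      Der 𝒯 Γ (.ty .set A) → Der 𝒯 (.Lst A :: Γ) (.ty .col L) → Der 𝒯 Γ (.tm s (.Lst A)) →
      Der 𝒯 Γ (.tm a (L.inst (.nil A))) →
      Der 𝒯 (L.instW 2 (.var 1) :: A.wk 1 :: .Lst A :: Γ)
        (.tm l (L.instW 3 (.cons (A.wk 3) (.var 2) (.var 1)))) →
      Der 𝒯 Γ (.tm (.elList A L s a l) (L.inst s))
  | Lst_beta_nil {Γ : Ctx} {A L : Exp .ty} {a l : Exp .tm} :
      Der 𝒯 Γ (.ty .set A) → Der 𝒯 (.Lst A :: Γ) (.ty .col L) →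
      Der 𝒯 Γ (.tm a (L.inst (.nil A))) →
      Der 𝒯 (L.instW 2 (.var 1) :: A.wk 1 :: .Lst A :: Γ)
        (.tm l (L.instW 3 (.cons (A.wk 3) (.var 2) (.var 1)))) →
      Der 𝒯 Γ (.tmEq (.elList A L (.nil A) a l) a (L.inst (.nil A)))
  | Lst_beta_cons {Γ : Ctx} {A L : Exp .ty} {s c a l : Exp .tm} :
      Der 𝒯 Γ (.ty .set A) → Der 𝒯 (.Lst A :: Γ) (.ty .col L) → Der 𝒯 Γ (.tm s (.Lst A)) →
      Der 𝒯 Γ (.tm c A) → Der 𝒯 Γ (.tm a (L.inst (.nil A))) →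
      Der 𝒯 (L.instW 2 (.var 1) :: A.wk 1 :: .Lst A :: Γ)
        (.tm l (L.instW 3 (.cons (A.wk 3) (.var 2) (.var 1)))) →
      Der 𝒯 Γ
        (.tmEq (.elList A L (.cons A s c) a l) (l.inst3 s c (.elList A L s a l))
          (L.inst (.cons A s c)))
  /- formation of propositions -/
  | bot_form {Γ : Ctx} :
      Der 𝒯 Γ .ctx → Der 𝒯 Γ (.ty .props .bot)
  | and_form {Γ : Ctx} {k : Kind} {φ ψ : Exp .ty} :
      k.IsLogic → Der 𝒯 Γ (.ty k φ) → Der 𝒯 Γ (.ty k ψ) → Der 𝒯 Γ (.ty k (.and φ ψ))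
  | or_form {Γ : Ctx} {k : Kind} {φ ψ : Exp .ty} :
      k.IsLogic → Der 𝒯 Γ (.ty k φ) → Der 𝒯 Γ (.ty k ψ) → Der 𝒯 Γ (.ty k (.or φ ψ))
  | imp_form {Γ : Ctx} {k : Kind} {φ ψ : Exp .ty} :
      k.IsLogic → Der 𝒯 Γ (.ty k φ) → Der 𝒯 Γ (.ty k ψ) → Der 𝒯 Γ (.ty k (.imp φ ψ))
  | all_form {Γ : Ctx} {k d : Kind} {A φ : Exp .ty} :
      k.LogicOver d → Der 𝒯 Γ (.ty d A) → Der 𝒯 (A :: Γ) (.ty k φ) → Der 𝒯 Γ (.ty k (.all A φ))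
  | ex_form {Γ : Ctx} {k d : Kind} {A φ : Exp .ty} :
      k.LogicOver d → Der 𝒯 Γ (.ty d A) → Der 𝒯 (A :: Γ) (.ty k φ) → Der 𝒯 Γ (.ty k (.ex A φ))
  /- `mTT` only: universe of small propositions, functions towards it -/
  | PropS_form {Γ : Ctx} :
      𝒯 = .mTT → Der 𝒯 Γ .ctx → Der 𝒯 Γ (.ty .col .PropS)
  | PropS_intro {Γ : Ctx} {φ : Exp .ty} :
      𝒯 = .mTT → Der 𝒯 Γ (.ty .props φ) → Der 𝒯 Γ (.tm (.hat φ) .PropS)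
  | PropS_elim {Γ : Ctx} {c : Exp .tm} :
      𝒯 = .mTT → Der 𝒯 Γ (.tm c .PropS) → Der 𝒯 Γ (.ty .props (.T c))
  | PropS_beta {Γ : Ctx} {φ : Exp .ty} :
      𝒯 = .mTT → Der 𝒯 Γ (.ty .props φ) → Der 𝒯 Γ (.tyEq .props (.T (.hat φ)) φ)
  | PropS_eta {Γ : Ctx} {c : Exp .tm} :
      𝒯 = .mTT → Der 𝒯 Γ (.tm c .PropS) → Der 𝒯 Γ (.tmEq (.hat (.T c)) c .PropS)
  | PropS_intro_eq {Γ : Ctx} {φ ψ : Exp .ty} :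
      𝒯 = .mTT → Der 𝒯 Γ (.tyEq .props φ ψ) → Der 𝒯 Γ (.tmEq (.hat φ) (.hat ψ) .PropS)
  | PropS_elim_eq {Γ : Ctx} {c d : Exp .tm} :
      𝒯 = .mTT → Der 𝒯 Γ (.tmEq c d .PropS) → Der 𝒯 Γ (.tyEq .props (.T c) (.T d))
  | Fun_form_PropS {Γ : Ctx} {A : Exp .ty} :
      𝒯 = .mTT → Der 𝒯 Γ (.ty .set A) → Der 𝒯 Γ (.ty .col (.Pi A .PropS))
  /- `mTT` only: falsum -/
  | m_bot_elim {Γ : Ctx} {φ : Exp .ty} {p : Exp .tm} :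
      𝒯 = .mTT → Der 𝒯 Γ (.ty .prop φ) → Der 𝒯 Γ (.tm p .bot) → Der 𝒯 Γ (.tm (.elBot φ p) φ)
  /- `mTT` only: conjunction -/
  | m_and_intro {Γ : Ctx} {φ ψ : Exp .ty} {p q : Exp .tm} :
      𝒯 = .mTT → Der 𝒯 Γ (.ty .prop φ) → Der 𝒯 Γ (.ty .prop ψ) → Der 𝒯 Γ (.tm p φ) →
      Der 𝒯 Γ (.tm q ψ) → Der 𝒯 Γ (.tm (.andI φ ψ p q) (.and φ ψ))
  | m_and_elim1 {Γ : Ctx} {φ ψ : Exp .ty} {p : Exp .tm} :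
      𝒯 = .mTT → Der 𝒯 Γ (.ty .prop φ) → Der 𝒯 Γ (.ty .prop ψ) → Der 𝒯 Γ (.tm p (.and φ ψ)) →
      Der 𝒯 Γ (.tm (.andE1 φ ψ p) φ)
  | m_and_elim2 {Γ : Ctx} {φ ψ : Exp .ty} {p : Exp .tm} :
      𝒯 = .mTT → Der 𝒯 Γ (.ty .prop φ) → Der 𝒯 Γ (.ty .prop ψ) → Der 𝒯 Γ (.tm p (.and φ ψ)) →
      Der 𝒯 Γ (.tm (.andE2 φ ψ p) ψ)
  | m_and_beta1 {Γ : Ctx} {φ ψ : Exp .ty} {p q : Exp .tm} :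
      𝒯 = .mTT → Der 𝒯 Γ (.ty .prop φ) → Der 𝒯 Γ (.ty .prop ψ) → Der 𝒯 Γ (.tm p φ) →
      Der 𝒯 Γ (.tm q ψ) → Der 𝒯 Γ (.tmEq (.andE1 φ ψ (.andI φ ψ p q)) p φ)
  | m_and_beta2 {Γ : Ctx} {φ ψ : Exp .ty} {p q : Exp .tm} :
      𝒯 = .mTT → Der 𝒯 Γ (.ty .prop φ) → Der 𝒯 Γ (.ty .prop ψ) → Der 𝒯 Γ (.tm p φ) →
      Der 𝒯 Γ (.tm q ψ) → Der 𝒯 Γ (.tmEq (.andE2 φ ψ (.andI φ ψ p q)) q ψ)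
  /- `mTT` only: disjunction -/
  | m_or_intro1 {Γ : Ctx} {φ ψ : Exp .ty} {p : Exp .tm} :
      𝒯 = .mTT → Der 𝒯 Γ (.ty .prop φ) → Der 𝒯 Γ (.ty .prop ψ) → Der 𝒯 Γ (.tm p φ) →
      Der 𝒯 Γ (.tm (.orI1 φ ψ p) (.or φ ψ))
  | m_or_intro2 {Γ : Ctx} {φ ψ : Exp .ty} {p : Exp .tm} :
      𝒯 = .mTT → Der 𝒯 Γ (.ty .prop φ) → Der 𝒯 Γ (.ty .prop ψ) → Der 𝒯 Γ (.tm p ψ) →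
      Der 𝒯 Γ (.tm (.orI2 φ ψ p) (.or φ ψ))
  | m_or_elim {Γ : Ctx} {φ ψ χ : Exp .ty} {p l r : Exp .tm} :
      𝒯 = .mTT → Der 𝒯 Γ (.ty .prop φ) → Der 𝒯 Γ (.ty .prop ψ) → Der 𝒯 Γ (.ty .prop χ) →
      Der 𝒯 Γ (.tm p (.or φ ψ)) → Der 𝒯 (φ :: Γ) (.tm l (χ.wk 1)) →
      Der 𝒯 (ψ :: Γ) (.tm r (χ.wk 1)) → Der 𝒯 Γ (.tm (.elOr φ ψ χ p l r) χ)
  | m_or_beta1 {Γ : Ctx} {φ ψ χ : Exp .ty} {p l r : Exp .tm} :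
      𝒯 = .mTT → Der 𝒯 Γ (.ty .prop φ) → Der 𝒯 Γ (.ty .prop ψ) → Der 𝒯 Γ (.ty .prop χ) →
      Der 𝒯 Γ (.tm p φ) → Der 𝒯 (φ :: Γ) (.tm l (χ.wk 1)) → Der 𝒯 (ψ :: Γ) (.tm r (χ.wk 1)) →
      Der 𝒯 Γ (.tmEq (.elOr φ ψ χ (.orI1 φ ψ p) l r) (l.inst p) χ)
  | m_or_beta2 {Γ : Ctx} {φ ψ χ : Exp .ty} {p l r : Exp .tm} :
      𝒯 = .mTT → Der 𝒯 Γ (.ty .prop φ) → Der 𝒯 Γ (.ty .prop ψ) → Der 𝒯 Γ (.ty .prop χ) →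
      Der 𝒯 Γ (.tm p ψ) → Der 𝒯 (φ :: Γ) (.tm l (χ.wk 1)) → Der 𝒯 (ψ :: Γ) (.tm r (χ.wk 1)) →
      Der 𝒯 Γ (.tmEq (.elOr φ ψ χ (.orI2 φ ψ p) l r) (r.inst p) χ)
  /- `mTT` only: implication -/
  | m_imp_intro {Γ : Ctx} {φ ψ : Exp .ty} {p : Exp .tm} :
      𝒯 = .mTT → Der 𝒯 Γ (.ty .prop φ) → Der 𝒯 Γ (.ty .prop ψ) → Der 𝒯 (φ :: Γ) (.tm p (ψ.wk 1)) →
      Der 𝒯 Γ (.tm (.impI φ ψ p) (.imp φ ψ))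
  | m_imp_elim {Γ : Ctx} {φ ψ : Exp .ty} {p q : Exp .tm} :
      𝒯 = .mTT → Der 𝒯 Γ (.ty .prop φ) → Der 𝒯 Γ (.ty .prop ψ) → Der 𝒯 Γ (.tm p (.imp φ ψ)) →
      Der 𝒯 Γ (.tm q φ) → Der 𝒯 Γ (.tm (.impE φ ψ p q) ψ)
  | m_imp_beta {Γ : Ctx} {φ ψ : Exp .ty} {p q : Exp .tm} :
      𝒯 = .mTT → Der 𝒯 Γ (.ty .prop φ) → Der 𝒯 Γ (.ty .prop ψ) → Der 𝒯 (φ :: Γ) (.tm p (ψ.wk 1)) →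
      Der 𝒯 Γ (.tm q φ) → Der 𝒯 Γ (.tmEq (.impE φ ψ (.impI φ ψ p) q) (p.inst q) ψ)
  /- `mTT` only: universal quantification -/
  | m_all_intro {Γ : Ctx} {A φ : Exp .ty} {p : Exp .tm} :
      𝒯 = .mTT → Der 𝒯 Γ (.ty .col A) → Der 𝒯 (A :: Γ) (.ty .prop φ) → Der 𝒯 (A :: Γ) (.tm p φ) →
      Der 𝒯 Γ (.tm (.allI A φ p) (.all A φ))
  | m_all_elim {Γ : Ctx} {A φ : Exp .ty} {p a : Exp .tm} :
      𝒯 = .mTT → Der 𝒯 Γ (.ty .col A) → Der 𝒯 (A :: Γ) (.ty .prop φ) →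
      Der 𝒯 Γ (.tm p (.all A φ)) → Der 𝒯 Γ (.tm a A) → Der 𝒯 Γ (.tm (.allE A φ p a) (φ.inst a))
  | m_all_beta {Γ : Ctx} {A φ : Exp .ty} {p a : Exp .tm} :
      𝒯 = .mTT → Der 𝒯 Γ (.ty .col A) → Der 𝒯 (A :: Γ) (.ty .prop φ) → Der 𝒯 (A :: Γ) (.tm p φ) →
      Der 𝒯 Γ (.tm a A) → Der 𝒯 Γ (.tmEq (.allE A φ (.allI A φ p) a) (p.inst a) (φ.inst a))
  /- `mTT` only: existential quantification -/
  | m_ex_intro {Γ : Ctx} {A φ : Exp .ty} {a p : Exp .tm} :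
      𝒯 = .mTT → Der 𝒯 Γ (.ty .col A) → Der 𝒯 (A :: Γ) (.ty .prop φ) → Der 𝒯 Γ (.tm a A) →
      Der 𝒯 Γ (.tm p (φ.inst a)) → Der 𝒯 Γ (.tm (.exI A φ a p) (.ex A φ))
  | m_ex_elim {Γ : Ctx} {A φ χ : Exp .ty} {p m : Exp .tm} :
      𝒯 = .mTT → Der 𝒯 Γ (.ty .col A) → Der 𝒯 (A :: Γ) (.ty .prop φ) → Der 𝒯 Γ (.ty .prop χ) →
      Der 𝒯 Γ (.tm p (.ex A φ)) → Der 𝒯 (φ :: A :: Γ) (.tm m (χ.wk 2)) →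
      Der 𝒯 Γ (.tm (.elEx A φ χ p m) χ)
  | m_ex_beta {Γ : Ctx} {A φ χ : Exp .ty} {a p m : Exp .tm} :
      𝒯 = .mTT → Der 𝒯 Γ (.ty .col A) → Der 𝒯 (A :: Γ) (.ty .prop φ) → Der 𝒯 Γ (.ty .prop χ) →
      Der 𝒯 Γ (.tm a A) → Der 𝒯 Γ (.tm p (φ.inst a)) → Der 𝒯 (φ :: A :: Γ) (.tm m (χ.wk 2)) →
      Der 𝒯 Γ (.tmEq (.elEx A φ χ (.exI A φ a p) m) (m.inst2 a p) χ)
  /- `mTT` only: propositional equality, with elimination towards propositions on its domain -/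
  | Id_form {Γ : Ctx} {k d : Kind} {A : Exp .ty} {a b : Exp .tm} :
      𝒯 = .mTT → k.LogicOver d → Der 𝒯 Γ (.ty d A) → Der 𝒯 Γ (.tm a A) → Der 𝒯 Γ (.tm b A) →
      Der 𝒯 Γ (.ty k (.Id A a b))
  | Id_intro {Γ : Ctx} {A : Exp .ty} {a : Exp .tm} :
      𝒯 = .mTT → Der 𝒯 Γ (.ty .col A) → Der 𝒯 Γ (.tm a A) → Der 𝒯 Γ (.tm (.idI A a) (.Id A a a))
  | Id_elim {Γ : Ctx} {A C : Exp .ty} {a b p c : Exp .tm} :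
      𝒯 = .mTT → Der 𝒯 Γ (.ty .col A) → Der 𝒯 (A.wk 1 :: A :: Γ) (.ty .prop C) →
      Der 𝒯 Γ (.tm a A) → Der 𝒯 Γ (.tm b A) → Der 𝒯 Γ (.tm p (.Id A a b)) →
      Der 𝒯 (A :: Γ) (.tm c (C.instW2 1 (.var 0) (.var 0))) →
      Der 𝒯 Γ (.tm (.elId A C a b p c) (C.inst2 a b))
  | Id_beta {Γ : Ctx} {A C : Exp .ty} {a c : Exp .tm} :
      𝒯 = .mTT → Der 𝒯 Γ (.ty .col A) → Der 𝒯 (A.wk 1 :: A :: Γ) (.ty .prop C) →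
      Der 𝒯 Γ (.tm a A) → Der 𝒯 (A :: Γ) (.tm c (C.instW2 1 (.var 0) (.var 0))) →
      Der 𝒯 Γ (.tmEq (.elId A C a a (.idI A a) c) (c.inst a) (C.inst2 a a))
  /- `emTT` only: congruence for the empty set -/
  | N0_elim_cong {Γ : Ctx} {M M' : Exp .ty} {a a' : Exp .tm} :
      𝒯.IsExt → Der 𝒯 (.N0 :: Γ) (.tyEq .col M M') → Der 𝒯 Γ (.tmEq a a' .N0) →
      Der 𝒯 Γ (.tmEq (.elN0 M a) (.elN0 M' a') (M.inst a))
  /- `emTT` only: congruence and eta for the singleton set -/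
  | N1_elim_cong {Γ : Ctx} {M M' : Exp .ty} {t t' c c' : Exp .tm} :
      𝒯.IsExt → Der 𝒯 (.N1 :: Γ) (.tyEq .col M M') → Der 𝒯 Γ (.tmEq t t' .N1) →
      Der 𝒯 Γ (.tmEq c c' (M.inst .star)) →
      Der 𝒯 Γ (.tmEq (.elN1 M t c) (.elN1 M' t' c') (M.inst t))
  | N1_eta {Γ : Ctx} {t : Exp .tm} :
      𝒯.IsExt → Der 𝒯 Γ (.tm t .N1) → Der 𝒯 Γ (.tmEq t .star .N1)
  /- `emTT` only: congruence for strong indexed sums -/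
  | Sigma_cong {Γ : Ctx} {k : Kind} {A A' B B' : Exp .ty} :
      𝒯.IsExt → k.IsMath → Der 𝒯 Γ (.tyEq k A A') → Der 𝒯 (A :: Γ) (.tyEq k B B') →
      Der 𝒯 Γ (.tyEq k (.Sigma A B) (.Sigma A' B'))
  | Sigma_intro_cong {Γ : Ctx} {A A' B B' : Exp .ty} {a a' b b' : Exp .tm} :
      𝒯.IsExt → Der 𝒯 Γ (.tyEq .col A A') → Der 𝒯 (A :: Γ) (.tyEq .col B B') →
      Der 𝒯 Γ (.tmEq a a' A) → Der 𝒯 Γ (.tmEq b b' (B.inst a)) →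
      Der 𝒯 Γ (.tmEq (.pair A B a b) (.pair A' B' a' b') (.Sigma A B))
  | Sigma_elim_cong {Γ : Ctx} {A A' B B' M M' : Exp .ty} {d d' m m' : Exp .tm} :
      𝒯.IsExt → Der 𝒯 Γ (.tyEq .col A A') → Der 𝒯 (A :: Γ) (.tyEq .col B B') →
      Der 𝒯 (.Sigma A B :: Γ) (.tyEq .col M M') → Der 𝒯 Γ (.tmEq d d' (.Sigma A B)) →
      Der 𝒯 (B :: A :: Γ) (.tmEq m m' (M.instW 2 (.pair (A.wk 2) (B.wkB 2) (.var 1) (.var 0)))) →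
      Der 𝒯 Γ (.tmEq (.elSigma A B M d m) (.elSigma A' B' M' d' m') (M.inst d))
  /- `emTT` only: functions towards `P1`; congruence and eta for products -/
  | Fun_form_P1 {Γ : Ctx} {A : Exp .ty} :
      𝒯.IsExt → Der 𝒯 Γ (.ty .set A) → Der 𝒯 Γ (.ty .col (.Pi A .P1))
  | Pi_eta {Γ : Ctx} {A B : Exp .ty} {f : Exp .tm} :
      𝒯.IsExt → Der 𝒯 Γ (.ty .col A) → Der 𝒯 (A :: Γ) (.ty .col B) →
      Der 𝒯 Γ (.ty .col (.Pi A B)) → Der 𝒯 Γ (.tm f (.Pi A B)) →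
      Der 𝒯 Γ (.tmEq (.lam A B (.app (A.wk 1) (B.wkB 1) (f.wk 1) (.var 0))) f (.Pi A B))
  | Pi_cong {Γ : Ctx} {A A' B B' : Exp .ty} :
      𝒯.IsExt → Der 𝒯 Γ (.tyEq .set A A') → Der 𝒯 (A :: Γ) (.tyEq .set B B') →
      Der 𝒯 Γ (.tyEq .set (.Pi A B) (.Pi A' B'))
  | Fun_cong {Γ : Ctx} {A A' : Exp .ty} :
      𝒯.IsExt → Der 𝒯 Γ (.tyEq .set A A') → Der 𝒯 Γ (.tyEq .col (.Pi A .P1) (.Pi A' .P1))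
  | Pi_intro_cong {Γ : Ctx} {A A' B B' : Exp .ty} {b b' : Exp .tm} :
      𝒯.IsExt → Der 𝒯 Γ (.tyEq .col A A') → Der 𝒯 (A :: Γ) (.tyEq .col B B') →
      Der 𝒯 Γ (.tyEq .col (.Pi A B) (.Pi A' B')) → Der 𝒯 (A :: Γ) (.tmEq b b' B) →
      Der 𝒯 Γ (.tmEq (.lam A B b) (.lam A' B' b') (.Pi A B))
  | Pi_elim_cong {Γ : Ctx} {A A' B B' : Exp .ty} {f f' a a' : Exp .tm} :
      𝒯.IsExt → Der 𝒯 Γ (.tyEq .col A A') → Der 𝒯 (A :: Γ) (.tyEq .col B B') →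
      Der 𝒯 Γ (.tyEq .col (.Pi A B) (.Pi A' B')) → Der 𝒯 Γ (.tmEq f f' (.Pi A B)) →
      Der 𝒯 Γ (.tmEq a a' A) → Der 𝒯 Γ (.tmEq (.app A B f a) (.app A' B' f' a') (B.inst a))
  /- `emTT` only: congruence for disjoint sums -/
  | Plus_cong {Γ : Ctx} {A A' B B' : Exp .ty} :
      𝒯.IsExt → Der 𝒯 Γ (.tyEq .set A A') → Der 𝒯 Γ (.tyEq .set B B') →
      Der 𝒯 Γ (.tyEq .set (.Plus A B) (.Plus A' B'))
  | Plus_intro1_cong {Γ : Ctx} {A A' B B' : Exp .ty} {a a' : Exp .tm} :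
      𝒯.IsExt → Der 𝒯 Γ (.tyEq .set A A') → Der 𝒯 Γ (.tyEq .set B B') → Der 𝒯 Γ (.tmEq a a' A) →
      Der 𝒯 Γ (.tmEq (.inl A B a) (.inl A' B' a') (.Plus A B))
  | Plus_intro2_cong {Γ : Ctx} {A A' B B' : Exp .ty} {b b' : Exp .tm} :
      𝒯.IsExt → Der 𝒯 Γ (.tyEq .set A A') → Der 𝒯 Γ (.tyEq .set B B') → Der 𝒯 Γ (.tmEq b b' B) →
      Der 𝒯 Γ (.tmEq (.inr A B b) (.inr A' B' b') (.Plus A B))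
  | Plus_elim_cong {Γ : Ctx} {A A' B B' M M' : Exp .ty} {w w' l l' r r' : Exp .tm} :
      𝒯.IsExt → Der 𝒯 Γ (.tyEq .set A A') → Der 𝒯 Γ (.tyEq .set B B') →
      Der 𝒯 (.Plus A B :: Γ) (.tyEq .col M M') → Der 𝒯 Γ (.tmEq w w' (.Plus A B)) →
      Der 𝒯 (A :: Γ) (.tmEq l l' (M.instW 1 (.inl (A.wk 1) (B.wk 1) (.var 0)))) →
      Der 𝒯 (B :: Γ) (.tmEq r r' (M.instW 1 (.inr (A.wk 1) (B.wk 1) (.var 0)))) →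
      Der 𝒯 Γ (.tmEq (.elPlus A B M w l r) (.elPlus A' B' M' w' l' r') (M.inst w))
  /- `emTT` only: congruence for lists -/
  | Lst_cong {Γ : Ctx} {A A' : Exp .ty} :
      𝒯.IsExt → Der 𝒯 Γ (.tyEq .set A A') → Der 𝒯 Γ (.tyEq .set (.Lst A) (.Lst A'))
  | Lst_nil_cong {Γ : Ctx} {A A' : Exp .ty} :
      𝒯.IsExt → Der 𝒯 Γ (.tyEq .set A A') → Der 𝒯 Γ (.tmEq (.nil A) (.nil A') (.Lst A))
  | Lst_cons_cong {Γ : Ctx} {A A' : Exp .ty} {s s' a a' : Exp .tm} :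
      𝒯.IsExt → Der 𝒯 Γ (.tyEq .set A A') → Der 𝒯 Γ (.tmEq s s' (.Lst A)) →
      Der 𝒯 Γ (.tmEq a a' A) → Der 𝒯 Γ (.tmEq (.cons A s a) (.cons A' s' a') (.Lst A))
  | Lst_elim_cong {Γ : Ctx} {A A' L L' : Exp .ty} {s s' a a' l l' : Exp .tm} :
      𝒯.IsExt → Der 𝒯 Γ (.tyEq .set A A') → Der 𝒯 (.Lst A :: Γ) (.tyEq .col L L') →
      Der 𝒯 Γ (.tmEq s s' (.Lst A)) → Der 𝒯 Γ (.tmEq a a' (L.inst (.nil A))) →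
      Der 𝒯 (L.instW 2 (.var 1) :: A.wk 1 :: .Lst A :: Γ)
        (.tmEq l l' (L.instW 3 (.cons (A.wk 3) (.var 2) (.var 1)))) →
      Der 𝒯 Γ (.tmEq (.elList A L s a l) (.elList A' L' s' a' l') (L.inst s))
  /- `emTT` only: quotients of sets by small equivalence relations -/
  | Quot_form {Γ : Ctx} {A R : Exp .ty} :
      𝒯.IsExt → Der 𝒯 Γ (.ty .set A) → Der 𝒯 (A.wk 1 :: A :: Γ) (.ty .props R) →
      Der 𝒯 (A :: Γ) (.tm .tru (R.instW2 1 (.var 0) (.var 0))) →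
      Der 𝒯 (R :: A.wk 1 :: A :: Γ) (.tm .tru (R.instW2 3 (.var 1) (.var 2))) →
      Der 𝒯 (R.instW2 4 (.var 2) (.var 1) :: R.instW2 3 (.var 2) (.var 1) ::
          A.wk 2 :: A.wk 1 :: A :: Γ)
        (.tm .tru (R.instW2 5 (.var 4) (.var 2))) → Der 𝒯 Γ (.ty .set (.Quot A R))
  | Quot_intro {Γ : Ctx} {A R : Exp .ty} {a : Exp .tm} :
      𝒯.IsExt → Der 𝒯 Γ (.ty .set A) → Der 𝒯 (A.wk 1 :: A :: Γ) (.ty .props R) →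
      Der 𝒯 Γ (.ty .set (.Quot A R)) → Der 𝒯 Γ (.tm a A) → Der 𝒯 Γ (.tm (.cls A R a) (.Quot A R))
  | Quot_eq {Γ : Ctx} {A R : Exp .ty} {a b : Exp .tm} :
      𝒯.IsExt → Der 𝒯 Γ (.ty .set A) → Der 𝒯 (A.wk 1 :: A :: Γ) (.ty .props R) →
      Der 𝒯 Γ (.ty .set (.Quot A R)) → Der 𝒯 Γ (.tm a A) → Der 𝒯 Γ (.tm b A) →
      Der 𝒯 Γ (.tm .tru (R.inst2 a b)) → Der 𝒯 Γ (.tmEq (.cls A R a) (.cls A R b) (.Quot A R))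
  | Quot_elim {Γ : Ctx} {A R L : Exp .ty} {l p : Exp .tm} :
      𝒯.IsExt → Der 𝒯 Γ (.ty .set A) → Der 𝒯 (A.wk 1 :: A :: Γ) (.ty .props R) →
      Der 𝒯 Γ (.ty .set (.Quot A R)) → Der 𝒯 (.Quot A R :: Γ) (.ty .col L) →
      Der 𝒯 Γ (.tm p (.Quot A R)) →
      Der 𝒯 (A :: Γ) (.tm l (L.instW 1 (.cls (A.wk 1) (R.wkB2 1) (.var 0)))) →
      Der 𝒯 (R :: A.wk 1 :: A :: Γ)
        (.tmEq (l.instW 3 (.var 2)) (l.instW 3 (.var 1))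
          (L.instW 3 (.cls (A.wk 3) (R.wkB2 3) (.var 2)))) →
      Der 𝒯 Γ (.tm (.elQ A R L l p) (L.inst p))
  | Quot_beta {Γ : Ctx} {A R L : Exp .ty} {l a : Exp .tm} :
      𝒯.IsExt → Der 𝒯 Γ (.ty .set A) → Der 𝒯 (A.wk 1 :: A :: Γ) (.ty .props R) →
      Der 𝒯 Γ (.ty .set (.Quot A R)) → Der 𝒯 (.Quot A R :: Γ) (.ty .col L) → Der 𝒯 Γ (.tm a A) →
      Der 𝒯 (A :: Γ) (.tm l (L.instW 1 (.cls (A.wk 1) (R.wkB2 1) (.var 0)))) →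
      Der 𝒯 (R :: A.wk 1 :: A :: Γ)
        (.tmEq (l.instW 3 (.var 2)) (l.instW 3 (.var 1))
          (L.instW 3 (.cls (A.wk 3) (R.wkB2 3) (.var 2)))) →
      Der 𝒯 Γ (.tmEq (.elQ A R L l (.cls A R a)) (l.inst a) (L.inst (.cls A R a)))
  | Quot_eff {Γ : Ctx} {A R : Exp .ty} {a b : Exp .tm} :
      𝒯.IsExt → Der 𝒯 Γ (.ty .set A) → Der 𝒯 (A.wk 1 :: A :: Γ) (.ty .props R) →
      Der 𝒯 Γ (.ty .set (.Quot A R)) → Der 𝒯 Γ (.tm a A) → Der 𝒯 Γ (.tm b A) →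
      Der 𝒯 Γ (.tmEq (.cls A R a) (.cls A R b) (.Quot A R)) → Der 𝒯 Γ (.tm .tru (R.inst2 a b))
  | Quot_cong {Γ : Ctx} {A A' R R' : Exp .ty} :
      𝒯.IsExt → Der 𝒯 Γ (.tyEq .set A A') → Der 𝒯 (A.wk 1 :: A :: Γ) (.tyEq .props R R') →
      Der 𝒯 Γ (.ty .set (.Quot A R)) → Der 𝒯 Γ (.ty .set (.Quot A' R')) →
      Der 𝒯 Γ (.tyEq .set (.Quot A R) (.Quot A' R'))
  | Quot_intro_cong {Γ : Ctx} {A A' R R' : Exp .ty} {a a' : Exp .tm} :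
      𝒯.IsExt → Der 𝒯 Γ (.tyEq .set A A') → Der 𝒯 (A.wk 1 :: A :: Γ) (.tyEq .props R R') →
      Der 𝒯 Γ (.tyEq .set (.Quot A R) (.Quot A' R')) → Der 𝒯 Γ (.tmEq a a' A) →
      Der 𝒯 Γ (.tmEq (.cls A R a) (.cls A' R' a') (.Quot A R))
  | Quot_elim_cong {Γ : Ctx} {A A' R R' L L' : Exp .ty} {l l' p p' : Exp .tm} :
      𝒯.IsExt → Der 𝒯 Γ (.tyEq .set A A') → Der 𝒯 (A.wk 1 :: A :: Γ) (.tyEq .props R R') →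
      Der 𝒯 Γ (.tyEq .set (.Quot A R) (.Quot A' R')) → Der 𝒯 (.Quot A R :: Γ) (.tyEq .col L L') →
      Der 𝒯 Γ (.tmEq p p' (.Quot A R)) →
      Der 𝒯 (A :: Γ) (.tmEq l l' (L.instW 1 (.cls (A.wk 1) (R.wkB2 1) (.var 0)))) →
      Der 𝒯 (R :: A.wk 1 :: A :: Γ)
        (.tmEq (l.instW 3 (.var 2)) (l.instW 3 (.var 1))
          (L.instW 3 (.cls (A.wk 3) (R.wkB2 3) (.var 2)))) →
      Der 𝒯 Γ (.tmEq (.elQ A R L l p) (.elQ A' R' L' l' p') (L.inst p))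
  /- `emTT` only: power collection of the singleton -/
  | P1_form {Γ : Ctx} :
      𝒯.IsExt → Der 𝒯 Γ .ctx → Der 𝒯 Γ (.ty .col .P1)
  | P1_intro {Γ : Ctx} {φ : Exp .ty} :
      𝒯.IsExt → Der 𝒯 Γ (.ty .props φ) → Der 𝒯 Γ (.tm (.brack φ) .P1)
  | P1_eq {Γ : Ctx} {φ ψ : Exp .ty} :
      𝒯.IsExt → Der 𝒯 Γ (.ty .props φ) → Der 𝒯 Γ (.ty .props ψ) → Der 𝒯 Γ (.tm .tru (.iff φ ψ)) →
      Der 𝒯 Γ (.tmEq (.brack φ) (.brack ψ) .P1)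
  | P1_eff {Γ : Ctx} {φ ψ : Exp .ty} :
      𝒯.IsExt → Der 𝒯 Γ (.ty .props φ) → Der 𝒯 Γ (.ty .props ψ) →
      Der 𝒯 Γ (.tmEq (.brack φ) (.brack ψ) .P1) → Der 𝒯 Γ (.tm .tru (.iff φ ψ))
  | P1_eta {Γ : Ctx} {U : Exp .tm} :
      𝒯.IsExt → Der 𝒯 Γ (.tm U .P1) → Der 𝒯 Γ (.tmEq (.brack (.Dc U)) U .P1)
  | P1_intro_cong {Γ : Ctx} {φ ψ : Exp .ty} :
      𝒯.IsExt → Der 𝒯 Γ (.tyEq .props φ ψ) → Der 𝒯 Γ (.tmEq (.brack φ) (.brack ψ) .P1)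
  /- `emTT` only: equality propositions and congruence for propositions -/
  | Eq_form {Γ : Ctx} {k d : Kind} {A : Exp .ty} {a b : Exp .tm} :
      𝒯.IsExt → k.LogicOver d → Der 𝒯 Γ (.ty d A) → Der 𝒯 Γ (.tm a A) → Der 𝒯 Γ (.tm b A) →
      Der 𝒯 Γ (.ty k (.Eq A a b))
  | Eq_P1_form {Γ : Ctx} {U V : Exp .tm} :
      𝒯.IsExt → Der 𝒯 Γ (.tm U .P1) → Der 𝒯 Γ (.tm V .P1) → Der 𝒯 Γ (.ty .props (.Eq .P1 U V))
  | and_cong {Γ : Ctx} {k : Kind} {φ φ' ψ ψ' : Exp .ty} :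
      𝒯.IsExt → k.IsLogic → Der 𝒯 Γ (.tyEq k φ φ') → Der 𝒯 Γ (.tyEq k ψ ψ') →
      Der 𝒯 Γ (.tyEq k (.and φ ψ) (.and φ' ψ'))
  | or_cong {Γ : Ctx} {k : Kind} {φ φ' ψ ψ' : Exp .ty} :
      𝒯.IsExt → k.IsLogic → Der 𝒯 Γ (.tyEq k φ φ') → Der 𝒯 Γ (.tyEq k ψ ψ') →
      Der 𝒯 Γ (.tyEq k (.or φ ψ) (.or φ' ψ'))
  | imp_cong {Γ : Ctx} {k : Kind} {φ φ' ψ ψ' : Exp .ty} :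
      𝒯.IsExt → k.IsLogic → Der 𝒯 Γ (.tyEq k φ φ') → Der 𝒯 Γ (.tyEq k ψ ψ') →
      Der 𝒯 Γ (.tyEq k (.imp φ ψ) (.imp φ' ψ'))
  | all_cong {Γ : Ctx} {k d : Kind} {A A' φ φ' : Exp .ty} :
      𝒯.IsExt → k.LogicOver d → Der 𝒯 Γ (.tyEq d A A') → Der 𝒯 (A :: Γ) (.tyEq k φ φ') →
      Der 𝒯 Γ (.tyEq k (.all A φ) (.all A' φ'))
  | ex_cong {Γ : Ctx} {k d : Kind} {A A' φ φ' : Exp .ty} :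
      𝒯.IsExt → k.LogicOver d → Der 𝒯 Γ (.tyEq d A A') → Der 𝒯 (A :: Γ) (.tyEq k φ φ') →
      Der 𝒯 Γ (.tyEq k (.ex A φ) (.ex A' φ'))
  | Eq_cong {Γ : Ctx} {k d : Kind} {A A' : Exp .ty} {a a' b b' : Exp .tm} :
      𝒯.IsExt → k.LogicOver d → Der 𝒯 Γ (.tyEq d A A') → Der 𝒯 Γ (.tmEq a a' A) →
      Der 𝒯 Γ (.tmEq b b' A) → Der 𝒯 Γ (.tyEq k (.Eq A a b) (.Eq A' a' b'))
  | Eq_P1_cong {Γ : Ctx} {U U' V V' : Exp .tm} :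
      𝒯.IsExt → Der 𝒯 Γ (.tmEq U U' .P1) → Der 𝒯 Γ (.tmEq V V' .P1) →
      Der 𝒯 Γ (.tyEq .props (.Eq .P1 U V) (.Eq .P1 U' V'))
  /- `emTT` only: proof-irrelevance -/
  | prop_mono {Γ : Ctx} {φ : Exp .ty} {p q : Exp .tm} :
      𝒯.IsExt → Der 𝒯 Γ (.ty .prop φ) → Der 𝒯 Γ (.tm p φ) → Der 𝒯 Γ (.tm q φ) →
      Der 𝒯 Γ (.tmEq p q φ)
  | prop_true {Γ : Ctx} {φ : Exp .ty} {p : Exp .tm} :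
      𝒯.IsExt → Der 𝒯 Γ (.ty .prop φ) → Der 𝒯 Γ (.tm p φ) → Der 𝒯 Γ (.tm .tru φ)
  /- `emTT` only: predicate logic -/
  | bot_elim {Γ : Ctx} {φ : Exp .ty} :
      𝒯.IsExt → Der 𝒯 Γ (.ty .prop φ) → Der 𝒯 Γ (.tm .tru .bot) → Der 𝒯 Γ (.tm .tru φ)
  | and_intro {Γ : Ctx} {φ ψ : Exp .ty} :
      𝒯.IsExt → Der 𝒯 Γ (.ty .prop φ) → Der 𝒯 Γ (.ty .prop ψ) → Der 𝒯 Γ (.tm .tru φ) →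
      Der 𝒯 Γ (.tm .tru ψ) → Der 𝒯 Γ (.tm .tru (.and φ ψ))
  | and_elim1 {Γ : Ctx} {φ ψ : Exp .ty} :
      𝒯.IsExt → Der 𝒯 Γ (.ty .prop φ) → Der 𝒯 Γ (.ty .prop ψ) → Der 𝒯 Γ (.tm .tru (.and φ ψ)) →
      Der 𝒯 Γ (.tm .tru φ)
  | and_elim2 {Γ : Ctx} {φ ψ : Exp .ty} :
      𝒯.IsExt → Der 𝒯 Γ (.ty .prop φ) → Der 𝒯 Γ (.ty .prop ψ) → Der 𝒯 Γ (.tm .tru (.and φ ψ)) →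
      Der 𝒯 Γ (.tm .tru ψ)
  | or_intro1 {Γ : Ctx} {φ ψ : Exp .ty} :
      𝒯.IsExt → Der 𝒯 Γ (.ty .prop φ) → Der 𝒯 Γ (.ty .prop ψ) → Der 𝒯 Γ (.tm .tru φ) →
      Der 𝒯 Γ (.tm .tru (.or φ ψ))
  | or_intro2 {Γ : Ctx} {φ ψ : Exp .ty} :
      𝒯.IsExt → Der 𝒯 Γ (.ty .prop φ) → Der 𝒯 Γ (.ty .prop ψ) → Der 𝒯 Γ (.tm .tru ψ) →
      Der 𝒯 Γ (.tm .tru (.or φ ψ))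
  | or_elim {Γ : Ctx} {φ ψ χ : Exp .ty} :
      𝒯.IsExt → Der 𝒯 Γ (.ty .prop φ) → Der 𝒯 Γ (.ty .prop ψ) → Der 𝒯 Γ (.ty .prop χ) →
      Der 𝒯 Γ (.tm .tru (.or φ ψ)) → Der 𝒯 (φ :: Γ) (.tm .tru (χ.wk 1)) →
      Der 𝒯 (ψ :: Γ) (.tm .tru (χ.wk 1)) → Der 𝒯 Γ (.tm .tru χ)
  | imp_intro {Γ : Ctx} {φ ψ : Exp .ty} :
      𝒯.IsExt → Der 𝒯 Γ (.ty .prop φ) → Der 𝒯 Γ (.ty .prop ψ) →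
      Der 𝒯 (φ :: Γ) (.tm .tru (ψ.wk 1)) → Der 𝒯 Γ (.tm .tru (.imp φ ψ))
  | imp_elim {Γ : Ctx} {φ ψ : Exp .ty} :
      𝒯.IsExt → Der 𝒯 Γ (.ty .prop φ) → Der 𝒯 Γ (.ty .prop ψ) → Der 𝒯 Γ (.tm .tru (.imp φ ψ)) →
      Der 𝒯 Γ (.tm .tru φ) → Der 𝒯 Γ (.tm .tru ψ)
  | all_intro {Γ : Ctx} {A φ : Exp .ty} :
      𝒯.IsExt → Der 𝒯 Γ (.ty .col A) → Der 𝒯 (A :: Γ) (.ty .prop φ) →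
      Der 𝒯 (A :: Γ) (.tm .tru φ) → Der 𝒯 Γ (.tm .tru (.all A φ))
  | all_elim {Γ : Ctx} {A φ : Exp .ty} {a : Exp .tm} :
      𝒯.IsExt → Der 𝒯 Γ (.ty .col A) → Der 𝒯 (A :: Γ) (.ty .prop φ) →
      Der 𝒯 Γ (.tm .tru (.all A φ)) → Der 𝒯 Γ (.tm a A) → Der 𝒯 Γ (.tm .tru (φ.inst a))
  | ex_intro {Γ : Ctx} {A φ : Exp .ty} {a : Exp .tm} :
      𝒯.IsExt → Der 𝒯 Γ (.ty .col A) → Der 𝒯 (A :: Γ) (.ty .prop φ) → Der 𝒯 Γ (.tm a A) →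
      Der 𝒯 Γ (.tm .tru (φ.inst a)) → Der 𝒯 Γ (.tm .tru (.ex A φ))
  | ex_elim {Γ : Ctx} {A φ χ : Exp .ty} :
      𝒯.IsExt → Der 𝒯 Γ (.ty .col A) → Der 𝒯 (A :: Γ) (.ty .prop φ) → Der 𝒯 Γ (.ty .prop χ) →
      Der 𝒯 Γ (.tm .tru (.ex A φ)) → Der 𝒯 (φ :: A :: Γ) (.tm .tru (χ.wk 2)) →
      Der 𝒯 Γ (.tm .tru χ)
  /- `emTT` only: propositional equality, with reflection -/
  | Eq_intro {Γ : Ctx} {A : Exp .ty} {a : Exp .tm} :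
      𝒯.IsExt → Der 𝒯 Γ (.ty .col A) → Der 𝒯 Γ (.tm a A) → Der 𝒯 Γ (.tm .tru (.Eq A a a))
  | Eq_elim {Γ : Ctx} {A : Exp .ty} {a b : Exp .tm} :
      𝒯.IsExt → Der 𝒯 Γ (.ty .col A) → Der 𝒯 Γ (.tm a A) → Der 𝒯 Γ (.tm b A) →
      Der 𝒯 Γ (.tm .tru (.Eq A a b)) → Der 𝒯 Γ (.tmEq a b A)
  /- propositional extensionality -/
  | propext {Γ : Ctx} {φ ψ : Exp .ty} :
      𝒯 = .emTTpropext → Der 𝒯 Γ (.ty .prop φ) → Der 𝒯 Γ (.ty .prop ψ) →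
      Der 𝒯 Γ (.tm .tru (.iff φ ψ)) → Der 𝒯 Γ (.tyEq .prop φ ψ)
  | prop_s_ext {Γ : Ctx} {φ ψ : Exp .ty} :
      𝒯 = .emTTpropext → Der 𝒯 Γ (.ty .props φ) → Der 𝒯 Γ (.ty .props ψ) →
      Der 𝒯 Γ (.tm .tru (.iff φ ψ)) → Der 𝒯 Γ (.tyEq .props φ ψ)

/-- The translation of the pre-syntax: `Id` becomes `Eq`, `PropS` becomes `P1`, `hat φ` becomes
`[φ]`, the decoding `T` becomes `Dc`, every constructor of proof-terms becomes the canonical proof-term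
`tru`, and all the other constructors are kept. -/
def tr : {c : Cat} → Exp c → Exp c
  | _, .var n => .var n
  | _, .N0 => .N0
  | _, .N1 => .N1
  | _, .Sigma A B => .Sigma (tr A) (tr B)
  | _, .Pi A B => .Pi (tr A) (tr B)
  | _, .Plus A B => .Plus (tr A) (tr B)
  | _, .Lst A => .Lst (tr A)
  | _, .bot => .bot
  | _, .and φ ψ => .and (tr φ) (tr ψ)
  | _, .or φ ψ => .or (tr φ) (tr ψ)
  | _, .imp φ ψ => .imp (tr φ) (tr ψ)
  | _, .all A φ => .all (tr A) (tr φ)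
  | _, .ex A φ => .ex (tr A) (tr φ)
  | _, .PropS => .P1
  | _, .T c => .Dc (tr c)
  | _, .Id A a b => .Eq (tr A) (tr a) (tr b)
  | _, .Quot A R => .Quot (tr A) (tr R)
  | _, .P1 => .P1
  | _, .Eq A a b => .Eq (tr A) (tr a) (tr b)
  | _, .elN0 M a => .elN0 (tr M) (tr a)
  | _, .star => .star
  | _, .elN1 M t c => .elN1 (tr M) (tr t) (tr c)
  | _, .pair A B a b => .pair (tr A) (tr B) (tr a) (tr b)
  | _, .elSigma A B M d m => .elSigma (tr A) (tr B) (tr M) (tr d) (tr m)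
  | _, .lam A B b => .lam (tr A) (tr B) (tr b)
  | _, .app A B f a => .app (tr A) (tr B) (tr f) (tr a)
  | _, .inl A B a => .inl (tr A) (tr B) (tr a)
  | _, .inr A B b => .inr (tr A) (tr B) (tr b)
  | _, .elPlus A B M w l r => .elPlus (tr A) (tr B) (tr M) (tr w) (tr l) (tr r)
  | _, .nil A => .nil (tr A)
  | _, .cons A s a => .cons (tr A) (tr s) (tr a)
  | _, .elList A L s a l => .elList (tr A) (tr L) (tr s) (tr a) (tr l)
  | _, .hat φ => .brack (tr φ)
  | _, .elBot _ _ => .tru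
  | _, .impI _ _ _ => .tru
  | _, .impE _ _ _ _ => .tru
  | _, .andI _ _ _ _ => .tru
  | _, .andE1 _ _ _ => .tru
  | _, .andE2 _ _ _ => .tru
  | _, .orI1 _ _ _ => .tru
  | _, .orI2 _ _ _ => .tru
  | _, .elOr _ _ _ _ _ _ => .tru
  | _, .allI _ _ _ => .tru
  | _, .allE _ _ _ _ => .tru
  | _, .exI _ _ _ _ => .tru
  | _, .elEx _ _ _ _ _ => .tru
  | _, .idI _ _ => .tru
  | _, .elId _ _ _ _ _ _ => .tru
  | _, .cls A R a => .cls (tr A) (tr R) (tr a)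
  | _, .elQ A R L l p => .elQ (tr A) (tr R) (tr L) (tr l) (tr p)
  | _, .brack φ => .brack (tr φ)
  | _, .tru => .tru

/-- The translation of contexts. -/
def trCtx (Γ : Ctx) : Ctx := Γ.map tr

end MF

namespace MF

/-! ### Calculus of renamings and substitutions on the pre-syntax. -/

namespace Exp

/-! The proof is one induction on derivations, `tr_of_mTT`, covering all five forms of judgement at
once. The translation commutes strictly with renaming and substitution (`tr_rename`, `tr_subst`),
even on ill-typed expressions, so every rule shared by the two theories is sent to itself. What
remains are the rules of `mTT` alone.

Logic: a translated proof-term `p` need not be `tru`, but proof-irrelevance replaces it by `tru`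
(`tru_intro`), after which introductions and eliminations become those of `emTT`. In a β-equality of
proof-terms the left side translates to `tru`, so by proof-irrelevance it is enough to type the
right side (`tmEq_tru`). Elimination of `Id` uses reflection: a proof of equality makes `a` and `b`
judgementally equal, hence also `C(a, a)` and `C(a, b)`, and the proof given on the diagonal is
converted (`tru_inst2_of_Eq`).

Universe: `hat (T c) = c` becomes the η-rule of `P1`. The equality `T (hat φ) = φ` becomes `Dc [φ] =
φ`, whose two sides are in general only equiprovable: `[φ] = [⊤]` holds exactly when `φ` is true, by
effectiveness in one direction and by the equality rule of `P1` in the other. Propositional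
extensionality turns this into an equality of types (`Dc_brack`), and it is used nowhere else.

The rules carry enough formation premises for well-formedness of contexts (`wf`) to be the only
presupposition that has to be proved. -/

theorem upr_comp_ups (σ : ℕ → Exp .tm) (ξ : ℕ → ℕ) :
    (fun n => ups σ (upr ξ n)) = ups (fun n => σ (ξ n)) := by
  funext n; cases n <;> rfl

theorem ups_var (ξ : ℕ → ℕ) :
    ups (fun n => .var (ξ n)) = fun n => .var (upr ξ n) := by
  funext n; cases n <;> rfl

theorem upr_id : upr (fun n => n) = fun n => n := by
  funext n; cases n <;> rfl

/-- Weakenings are renamings, so this fusion law replaces the general law for composing two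
substitutions. -/
theorem subst_rename {c : Cat} (e : Exp c) (ξ : ℕ → ℕ) (σ : ℕ → Exp .tm) :
    (e.rename ξ).subst σ = e.subst (fun n => σ (ξ n)) := by
  induction e generalizing ξ σ <;> simp_all [rename, subst, upr_comp_ups]

theorem rename_eq_subst {c : Cat} (e : Exp c) (ξ : ℕ → ℕ) :
    e.rename ξ = e.subst (fun n => .var (ξ n)) := by
  induction e generalizing ξ <;> simp_all [rename, subst, ups_var]

theorem rename_id {c : Cat} (e : Exp c) : e.rename (fun n => n) = e := by
  induction e <;> simp_all [rename, upr_id]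

theorem subst_var {c : Cat} (e : Exp c) : e.subst (fun n => .var n) = e := by
  rw [← rename_eq_subst e (fun n => n), rename_id]

theorem wk_eq_subst {c : Cat} (k : ℕ) (e : Exp c) : e.wk k = e.subst (sh k) :=
  rename_eq_subst e _

theorem wk_subst {c : Cat} (k : ℕ) (e : Exp c) (σ : ℕ → Exp .tm) :
    (e.wk k).subst σ = e.subst (fun n => σ (n + k)) :=
  subst_rename e _ σ

theorem wk_inst {c : Cat} (e : Exp c) (a : Exp .tm) : (e.wk 1).inst a = e := by
  rw [inst, wk_subst]; exact subst_var e

theorem wk_inst2 {c : Cat} (e : Exp c) (a b : Exp .tm) : (e.wk 2).inst2 a b = e := by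
  rw [inst2, wk_subst]; exact subst_var e

/-- The diagonal substitution has only variables as entries, hence is a renaming, and `subst_rename`
applies. Truncated subtraction `n - 1` identifies the indices 0 and 1 and lowers all the others. -/
theorem instW2_diag_inst {c : Cat} (e : Exp c) (a : Exp .tm) :
    (e.instW2 1 (.var 0) (.var 0)).inst a = e.inst2 a a := by
  have h : scons (.var 0) (scons (.var 0) (sh 1)) = fun n => .var (n - 1) := by
    funext n; rcases n with _ | _ | n <;> rfl
  rw [instW2, h, ← rename_eq_subst e (fun n => n - 1), inst, subst_rename, inst2]
  congr 1
  funext n; rcases n with _ | _ | n <;> rfl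

end Exp

open Exp

/-! ### The translation commutes with renaming and substitution. -/

theorem tr_rename {c : Cat} (e : Exp c) (ξ : ℕ → ℕ) :
    tr (e.rename ξ) = (tr e).rename ξ := by
  induction e generalizing ξ <;> simp_all [rename, tr, Dc, top, neg]

theorem tr_wk {c : Cat} (k : ℕ) (e : Exp c) : tr (e.wk k) = (tr e).wk k := tr_rename e _

theorem tr_wkB {c : Cat} (k : ℕ) (e : Exp c) : tr (e.wkB k) = (tr e).wkB k := tr_rename e _

theorem tr_ups (σ : ℕ → Exp .tm) : (fun n => tr (ups σ n)) = ups (fun n => tr (σ n)) := by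
  funext n
  cases n with
  | zero => rfl
  | succ n => exact tr_wk 1 (σ n)

/-- The erased proof-terms cause no trouble, since `tru` is closed; neither does the expansion of
`T` into `Dc`, since `top` is closed too. -/
theorem tr_subst {c : Cat} (e : Exp c) (σ : ℕ → Exp .tm) :
    tr (e.subst σ) = (tr e).subst (fun n => tr (σ n)) := by
  induction e generalizing σ <;> simp_all [subst, tr, Dc, top, neg, tr_ups]

theorem tr_scons (a : Exp .tm) (σ : ℕ → Exp .tm) :
    (fun n => tr (scons a σ n)) = scons (tr a) (fun n => tr (σ n)) := by
  funext n; cases n <;> rfl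

theorem tr_sh (k : ℕ) : (fun n => tr (sh k n)) = sh k := rfl

theorem tr_inst {c : Cat} (e : Exp c) (a : Exp .tm) : tr (e.inst a) = (tr e).inst (tr a) := by
  simp only [inst, tr_subst, tr_scons, tr_sh]

theorem tr_inst2 {c : Cat} (e : Exp c) (a b : Exp .tm) :
    tr (e.inst2 a b) = (tr e).inst2 (tr a) (tr b) := by
  simp only [inst2, tr_subst, tr_scons, tr_sh]

theorem tr_inst3 {c : Cat} (e : Exp c) (a b d : Exp .tm) :
    tr (e.inst3 a b d) = (tr e).inst3 (tr a) (tr b) (tr d) := by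
  simp only [inst3, tr_subst, tr_scons, tr_sh]

theorem tr_instW {c : Cat} (k : ℕ) (e : Exp c) (a : Exp .tm) :
    tr (e.instW k a) = (tr e).instW k (tr a) := by
  simp only [instW, tr_subst, tr_scons, tr_sh]

theorem tr_instW2 {c : Cat} (k : ℕ) (e : Exp c) (a b : Exp .tm) :
    tr (e.instW2 k a b) = (tr e).instW2 k (tr a) (tr b) := by
  simp only [instW2, tr_subst, tr_scons, tr_sh]

/-- The translation of the body of a judgement. -/
def Stmt.tr : Stmt → Stmt
  | .ctx => .ctx
  | .ty k A => .ty k (MF.tr A)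
  | .tyEq k A B => .tyEq k (MF.tr A) (MF.tr B)
  | .tm a A => .tm (MF.tr a) (MF.tr A)
  | .tmEq a b A => .tmEq (MF.tr a) (MF.tr b) (MF.tr A)

theorem Stmt.tr_subst (S : Stmt) (σ : ℕ → Exp .tm) :
    (S.subst σ).tr = S.tr.subst (fun n => MF.tr (σ n)) := by
  cases S <;> simp only [Stmt.subst, Stmt.tr, MF.tr_subst]

theorem trCtx_cons (A : Exp .ty) (Γ : Ctx) : trCtx (A :: Γ) = tr A :: trCtx Γ := rfl

/-- Lets the induction hypotheses on the entries of a telescopic substitution be used when its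
domain is a translated context. -/
theorem trCtx_getElem? {Γ : Ctx} {i : ℕ} {A : Exp .ty} (h : (trCtx Γ)[i]? = some A) :
    ∃ B, Γ[i]? = some B ∧ tr B = A := by
  simpa [trCtx] using h

/-! ### Structural properties: well-formed contexts, weakening, instantiation. -/

namespace Der

variable {𝒯 : Theory} {Γ : Ctx}

/-- The context of a derivable judgement is well formed. -/
theorem wf {S : Stmt} (h : Der 𝒯 Γ S) : Der 𝒯 Γ .ctx := by
  induction h
  case ctx_nil => exact .ctx_nil
  case ctx_cons h _ => exact .ctx_cons h
  -- Every other rule has a premise in the context of its conclusion; for the substitution rules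
  -- this is the well-formedness of the target context.
  all_goals assumption

/-- Weakening is the substitution rule along shifted variables, so only the types of these variables
have to be checked. -/
theorem weaken (Δ : Ctx) {S : Stmt} (h : Der 𝒯 Γ S) (hΔ : Der 𝒯 (Δ ++ Γ) .ctx) :
    Der 𝒯 (Δ ++ Γ) (S.subst (sh Δ.length)) := by
  refine .subst h hΔ fun i A hA => ?_
  have hv : Der 𝒯 (Δ ++ Γ) (.tm (.var (i + Δ.length)) (A.wk (i + Δ.length + 1))) :=
    .var hΔ (by rw [List.getElem?_append_right (by omega)]; simpa using hA)
  rw [wk_subst]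
  rw [wk_eq_subst] at hv
  have hσ : (fun n => sh Δ.length (n + (i + 1))) = sh (i + Δ.length + 1) := by
    funext n
    simp only [sh]
    congr 1
    omega
  rw [hσ]
  exact hv

theorem ty_wk1 {k : Kind} {A B : Exp .ty} (h : Der 𝒯 Γ (.ty k B)) (hA : Der 𝒯 (A :: Γ) .ctx) :
    Der 𝒯 (A :: Γ) (.ty k (B.wk 1)) := by
  rw [wk_eq_subst]; exact weaken [A] h hA

theorem ty_wk2 {k : Kind} {A B C : Exp .ty} (h : Der 𝒯 Γ (.ty k C))
    (hA : Der 𝒯 (B :: A :: Γ) .ctx) : Der 𝒯 (B :: A :: Γ) (.ty k (C.wk 2)) := by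
  rw [wk_eq_subst]; exact weaken [B, A] h hA

/-- The entries of the identity substitution have their types. -/
theorem var_sh_zero {i : ℕ} {A : Exp .ty} (hΓ : Der 𝒯 Γ .ctx) (hA : Γ[i]? = some A) :
    Der 𝒯 Γ (.tm (.var i) (A.subst (fun n => sh 0 (n + i + 1)))) := by
  have := Der.var hΓ hA
  rwa [wk_eq_subst] at this

theorem subst1 {A : Exp .ty} {a : Exp .tm} {S : Stmt} (h : Der 𝒯 (A :: Γ) S)
    (ha : Der 𝒯 Γ (.tm a A)) : Der 𝒯 Γ (S.subst (scons a (sh 0))) := by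
  refine .subst h ha.wf fun i B hB => ?_
  rcases i with _ | i
  · obtain rfl : A = B := by simpa using hB
    have : (A.wk 1).subst (scons a (sh 0)) = A := wk_inst A a
    rw [this]; exact ha
  · rw [wk_subst]; exact var_sh_zero ha.wf hB

theorem subst2 {A B : Exp .ty} {a b : Exp .tm} {S : Stmt} (h : Der 𝒯 (B :: A :: Γ) S)
    (ha : Der 𝒯 Γ (.tm a A)) (hb : Der 𝒯 Γ (.tm b (B.inst a))) :
    Der 𝒯 Γ (S.subst (scons b (scons a (sh 0)))) := by
  refine .subst h ha.wf fun i C hC => ?_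
  rcases i with _ | _ | i
  · obtain rfl : B = C := by simpa using hC
    -- Dropping entry 0 leaves, by computation, the substitution that defines `B.inst a`.
    rw [wk_subst]; exact hb
  · obtain rfl : A = C := by simpa using hC
    rw [wk_subst]
    have : A.subst (fun n => sh 0 n) = A := subst_var A
    change Der 𝒯 Γ (.tm a (A.subst (fun n => sh 0 n)))
    rw [this]; exact ha
  · rw [wk_subst]; exact var_sh_zero ha.wf hC

theorem tm_inst {A B : Exp .ty} {a b : Exp .tm} (h : Der 𝒯 (A :: Γ) (.tm b B))
    (ha : Der 𝒯 Γ (.tm a A)) : Der 𝒯 Γ (.tm (b.inst a) (B.inst a)) := subst1 h ha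

theorem ty_inst {k : Kind} {A B : Exp .ty} {a : Exp .tm} (h : Der 𝒯 (A :: Γ) (.ty k B))
    (ha : Der 𝒯 Γ (.tm a A)) : Der 𝒯 Γ (.ty k (B.inst a)) := subst1 h ha

/-- Disjunction, implication and existence have branches or bodies whose type does not depend on the
bound variables. This lemma and `tm_wk_inst2` type the contracta of their β-rules. -/
theorem tm_wk_inst {A B : Exp .ty} {a b : Exp .tm} (h : Der 𝒯 (A :: Γ) (.tm b (B.wk 1)))
    (ha : Der 𝒯 Γ (.tm a A)) : Der 𝒯 Γ (.tm (b.inst a) B) := by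
  have := tm_inst h ha
  rwa [wk_inst] at this

theorem tm_wk_inst2 {A B C : Exp .ty} {a b c : Exp .tm}
    (h : Der 𝒯 (B :: A :: Γ) (.tm c (C.wk 2))) (ha : Der 𝒯 Γ (.tm a A))
    (hb : Der 𝒯 Γ (.tm b (B.inst a))) : Der 𝒯 Γ (.tm (c.inst2 a b) C) := by
  have : Der 𝒯 Γ (.tm (c.inst2 a b) ((C.wk 2).inst2 a b)) := subst2 h ha hb
  rwa [wk_inst2] at this

theorem prop_col {φ : Exp .ty} (h : Der 𝒯 Γ (.ty .prop φ)) : Der 𝒯 Γ (.ty .col φ) :=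
  .incl .prop_col h

theorem props_prop {φ : Exp .ty} (h : Der 𝒯 Γ (.ty .props φ)) : Der 𝒯 Γ (.ty .prop φ) :=
  .incl .props_prop h

/-- Equal terms in the second argument of a type depending on two elements of `A`. -/
theorem tyEq_inst2_right {k : Kind} {A C : Exp .ty} {a b : Exp .tm}
    (hC : Der 𝒯 (A.wk 1 :: A :: Γ) (.ty k C)) (ha : Der 𝒯 Γ (.tm a A))
    (hab : Der 𝒯 Γ (.tmEq a b A)) : Der 𝒯 Γ (.tyEq k (C.inst2 a a) (C.inst2 a b)) := by
  -- The two substitutions differ only at index 0, where `hab` applies; reflexivity serves all other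
  -- entries.
  refine .subT hC ha.wf fun i B hB => ?_
  have hA : A.subst (fun n => sh 0 n) = A := subst_var A
  rcases i with _ | _ | i
  · obtain rfl : A.wk 1 = B := by simpa using hB
    rw [wk_subst, wk_subst]
    change Der 𝒯 Γ (.tmEq a b (A.subst (fun n => sh 0 n)))
    rwa [hA]
  · obtain rfl : A = B := by simpa using hB
    rw [wk_subst]
    change Der 𝒯 Γ (.tmEq a a (A.subst (fun n => sh 0 n)))
    rw [hA]; exact .ref ha
  · rw [wk_subst]; exact .ref (var_sh_zero ha.wf hB)

/-! ### Truth in the extensional theories, and the decoding `Dc`. -/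

/-- Proof-irrelevance: all inhabited propositions are inhabited by `tru`. -/
theorem tru_intro (h𝒯 : 𝒯.IsExt) {φ : Exp .ty} {p : Exp .tm} (hp : Der 𝒯 Γ (.tm p φ))
    (hφ : Der 𝒯 Γ (.ty .prop φ)) : Der 𝒯 Γ (.tm .tru φ) :=
  .prop_true h𝒯 hφ hp

/-- A hypothesis of a proposition makes it true. -/
theorem tru_hyp (h𝒯 : 𝒯.IsExt) {φ : Exp .ty} (hφ : Der 𝒯 Γ (.ty .prop φ)) :
    Der 𝒯 (φ :: Γ) (.tm .tru (φ.wk 1)) :=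
  have hc : Der 𝒯 (φ :: Γ) .ctx := .ctx_cons hφ.prop_col
  .prop_true h𝒯 (ty_wk1 hφ hc) (.var (i := 0) hc rfl)

theorem top_form (hΓ : Der 𝒯 Γ .ctx) : Der 𝒯 Γ (.ty .props top) :=
  .imp_form .props (.bot_form hΓ) (.bot_form hΓ)

theorem top_true (h𝒯 : 𝒯.IsExt) (hΓ : Der 𝒯 Γ .ctx) : Der 𝒯 Γ (.tm .tru top) :=
  .imp_intro h𝒯 (.props_prop (.bot_form hΓ)) (.props_prop (.bot_form hΓ))
    (tru_hyp h𝒯 (.props_prop (.bot_form hΓ)))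

/-- Equality over a collection is in general a proposition that need not be small. The special rule
for equality on `P1` gives the smallness required of the translation of `T c`. -/
theorem Dc_form (h𝒯 : 𝒯.IsExt) {U : Exp .tm} (hU : Der 𝒯 Γ (.tm U .P1)) :
    Der 𝒯 Γ (.ty .props (Dc U)) :=
  .Eq_P1_form h𝒯 hU (.P1_intro h𝒯 (top_form hU.wf))

theorem Dc_cong (h𝒯 : 𝒯.IsExt) {U V : Exp .tm} (hUV : Der 𝒯 Γ (.tmEq U V .P1)) :
    Der 𝒯 Γ (.tyEq .props (Dc U) (Dc V)) :=
  .Eq_P1_cong h𝒯 hUV (.ref (.P1_intro h𝒯 (top_form hUV.wf)))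

/-- The decoding of a class `[φ]` is true only if `φ` is. -/
theorem tru_of_Dc_brack (h𝒯 : 𝒯.IsExt) {φ : Exp .ty} (hφ : Der 𝒯 Γ (.ty .props φ))
    (h : Der 𝒯 Γ (.tm .tru (Dc (.brack φ)))) : Der 𝒯 Γ (.tm .tru φ) := by
  have ht := top_form h.wf
  have he : Der 𝒯 Γ (.tmEq (.brack φ) (.brack top) .P1) :=
    .Eq_elim h𝒯 (.P1_form h𝒯 h.wf) (.P1_intro h𝒯 hφ) (.P1_intro h𝒯 ht) h
  -- Reflection has given `[φ] = [⊤]`; effectiveness of `P1` gives back `φ ⇔ ⊤`, of which the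
  -- converse half is needed.
  have hi : Der 𝒯 Γ (.tm .tru (.imp top φ)) :=
    .and_elim2 h𝒯 (.imp_form .prop hφ.props_prop ht.props_prop)
      (.imp_form .prop ht.props_prop hφ.props_prop) (.P1_eff h𝒯 hφ ht he)
  exact .imp_elim h𝒯 ht.props_prop hφ.props_prop hi (top_true h𝒯 h.wf)

theorem imp_of_tru (h𝒯 : 𝒯.IsExt) {φ ψ : Exp .ty} (hφ : Der 𝒯 Γ (.ty .prop φ))
    (hψ : Der 𝒯 Γ (.ty .prop ψ)) (h : Der 𝒯 Γ (.tm .tru ψ)) : Der 𝒯 Γ (.tm .tru (.imp φ ψ)) := by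
  have hc : Der 𝒯 (φ :: Γ) .ctx := .ctx_cons hφ.prop_col
  have hw : Der 𝒯 (φ :: Γ) (.tm .tru (ψ.wk 1)) := by
    rw [wk_eq_subst]; exact weaken [φ] h hc
  exact .imp_intro h𝒯 hφ hψ hw

/-- The decoding of a class `[φ]` is true if `φ` is. -/
theorem Dc_brack_of_tru (h𝒯 : 𝒯.IsExt) {φ : Exp .ty} (hφ : Der 𝒯 Γ (.ty .props φ))
    (h : Der 𝒯 Γ (.tm .tru φ)) : Der 𝒯 Γ (.tm .tru (Dc (.brack φ))) := by
  have ht := top_form h.wf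
  have htp := ht.props_prop
  have hφp := hφ.props_prop
  have he : Der 𝒯 Γ (.tmEq (.brack φ) (.brack top) .P1) :=
    .P1_eq h𝒯 hφ ht (.and_intro h𝒯 (.imp_form .prop hφp htp) (.imp_form .prop htp hφp)
      (imp_of_tru h𝒯 hφp htp (top_true h𝒯 h.wf)) (imp_of_tru h𝒯 htp hφp h))
  have hb := Der.P1_intro h𝒯 hφ
  -- Reflexivity proves `Eq P1 [φ] [φ]`; congruence in the second argument along `[φ] = [⊤]` makes
  -- this proposition equal to `Dc [φ]`.
  exact .conv (.Eq_intro h𝒯 (.P1_form h𝒯 h.wf) hb)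
    (.inclEq .prop_col (.inclEq .props_prop (.Eq_P1_cong h𝒯 (.ref hb) he)))

/-- Decoding is a left inverse of coding, by propositional extensionality. -/
theorem Dc_brack {φ : Exp .ty} (hφ : Der .emTTpropext Γ (.ty .props φ)) :
    Der .emTTpropext Γ (.tyEq .props (Dc (.brack φ)) φ) := by
  have h𝒯 := Theory.IsExt.emTTpropext
  have hD := Dc_form h𝒯 (.P1_intro h𝒯 hφ)
  have hφp := hφ.props_prop
  have hDp := hD.props_prop
  -- Each implication is proved under its hypothesis, in the extended context, by the two preceding
  -- lemmas on `Dc`.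
  refine .prop_s_ext rfl hD hφ
    (.and_intro h𝒯 (.imp_form .prop hDp hφp) (.imp_form .prop hφp hDp)
      (.imp_intro h𝒯 hDp hφp (tru_of_Dc_brack h𝒯 (ty_wk1 hφ (.ctx_cons hDp.prop_col)) ?_))
      (.imp_intro h𝒯 hφp hDp
        (Dc_brack_of_tru h𝒯 (ty_wk1 hφ (.ctx_cons hφp.prop_col)) (tru_hyp h𝒯 hφp))))
  -- Weakening passes through `Dc` and `brack` by computation, so the hypothesis has the required
  -- type.
  exact tru_hyp h𝒯 hDp

/-- Settles all β-equalities of proof-terms: the redex translates to `tru`, and `p` is the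
translated contractum. -/
theorem tmEq_tru (h𝒯 : 𝒯.IsExt) {φ : Exp .ty} {p : Exp .tm} (hp : Der 𝒯 Γ (.tm p φ))
    (hφ : Der 𝒯 Γ (.ty .prop φ)) : Der 𝒯 Γ (.tmEq .tru p φ) :=
  .prop_mono h𝒯 hφ (tru_intro h𝒯 hp hφ) hp

theorem ty_inst2 {k : Kind} {A C : Exp .ty} {a b : Exp .tm}
    (hC : Der 𝒯 (A.wk 1 :: A :: Γ) (.ty k C)) (ha : Der 𝒯 Γ (.tm a A))
    (hb : Der 𝒯 Γ (.tm b A)) : Der 𝒯 Γ (.ty k (C.inst2 a b)) :=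
  subst2 hC ha (by rwa [wk_inst])

theorem tm_diag_inst {A C : Exp .ty} {a c : Exp .tm}
    (hc : Der 𝒯 (A :: Γ) (.tm c (C.instW2 1 (.var 0) (.var 0)))) (ha : Der 𝒯 Γ (.tm a A)) :
    Der 𝒯 Γ (.tm (c.inst a) (C.inst2 a a)) := by
  have := tm_inst hc ha
  rwa [instW2_diag_inst] at this

/-- Elimination of equality towards propositions depending on its domain. -/
theorem tru_inst2_of_Eq (h𝒯 : 𝒯.IsExt) {A C : Exp .ty} {a b p c : Exp .tm}
    (hA : Der 𝒯 Γ (.ty .col A)) (hC : Der 𝒯 (A.wk 1 :: A :: Γ) (.ty .prop C))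
    (ha : Der 𝒯 Γ (.tm a A)) (hb : Der 𝒯 Γ (.tm b A)) (hp : Der 𝒯 Γ (.tm p (.Eq A a b)))
    (hc : Der 𝒯 (A :: Γ) (.tm c (C.instW2 1 (.var 0) (.var 0)))) :
    Der 𝒯 Γ (.tm .tru (C.inst2 a b)) := by
  -- Reflection makes the equality judgemental, so the proof of `C(a, a)` converts to one of `C(a,
  -- b)`.
  have hab : Der 𝒯 Γ (.tmEq a b A) :=
    .Eq_elim h𝒯 hA ha hb (tru_intro h𝒯 hp (.Eq_form h𝒯 .large hA ha hb))
  exact tru_intro h𝒯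
    (.conv (tm_diag_inst hc ha) (.inclEq .prop_col (tyEq_inst2_right hC ha hab)))
    (ty_inst2 hC ha hb)

/-! ### The induction on derivations of `mTT`. -/

theorem not_isExt_mTT : ¬ Theory.IsExt .mTT := nofun

set_option maxHeartbeats 2000000 in
/-- The translation of a derivable judgement of `mTT` is derivable in `emTT` with propositional
extensionality. -/
theorem tr_of_mTT {Γ : Ctx} {S : Stmt} (h : Der .mTT Γ S) :
    Der .emTTpropext (trCtx Γ) S.tr := by
  have E := Theory.IsExt.emTTpropext
  induction h
  -- The rules absent from `mTT` carry a side condition on the theory that fails here.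
  case propext h _ _ _ _ _ _ => exact nomatch h
  case prop_s_ext h _ _ _ _ _ _ => exact nomatch h
  all_goals try exact absurd ‹Theory.IsExt .mTT› not_isExt_mTT
  case subst h₁ h₂ h₃ =>
    rw [Stmt.tr_subst]
    -- The translated judgement is substituted along `tr ∘ σ`, whose entries are typed by the
    -- induction hypotheses.
    refine .subst h₁ h₂ fun i A hA => ?_
    obtain ⟨B, hB, rfl⟩ := trCtx_getElem? hA
    simpa only [Stmt.tr, tr_subst, tr_wk] using h₃ i B hB
  case PropS_form h => exact .P1_form E h
  case PropS_intro h => exact .P1_intro E h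
  case PropS_elim h => exact Dc_form E h
  case PropS_beta h => exact Dc_brack h
  case PropS_eta h => exact .P1_eta E h
  case PropS_intro_eq h => exact .P1_intro_cong E h
  case PropS_elim_eq h => exact Dc_cong E h
  case Fun_form_PropS h => exact .Fun_form_P1 E h
  -- From here on, `tru_intro` needs each premise's proposition to be well formed; this is rebuilt
  -- from the formation premises of the rule.
  case m_bot_elim hφ hp => exact .bot_elim E hφ (tru_intro E hp (.props_prop (.bot_form hp.wf)))
  case m_and_intro hφ hψ hp hq => exact .and_intro E hφ hψ (tru_intro E hp hφ) (tru_intro E hq hψ)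
  case m_and_elim1 hφ hψ hp => exact .and_elim1 E hφ hψ (tru_intro E hp (.and_form .prop hφ hψ))
  case m_and_elim2 hφ hψ hp => exact .and_elim2 E hφ hψ (tru_intro E hp (.and_form .prop hφ hψ))
  case m_and_beta1 hφ _ hp _ => exact tmEq_tru E hp hφ
  case m_and_beta2 _ hψ _ hq => exact tmEq_tru E hq hψ
  case m_or_intro1 hφ hψ hp => exact .or_intro1 E hφ hψ (tru_intro E hp hφ)
  case m_or_intro2 hφ hψ hp => exact .or_intro2 E hφ hψ (tru_intro E hp hψ)
  case m_or_elim hφ hψ hχ hp hl hr =>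
    simp only [Stmt.tr, tr_wk] at hl hr
    exact .or_elim E hφ hψ hχ (tru_intro E hp (.or_form .prop hφ hψ))
      (tru_intro E hl (ty_wk1 hχ hl.wf))
      (tru_intro E hr (ty_wk1 hχ hr.wf))
  case m_or_beta1 _ _ hχ hp hl _ =>
    simp only [Stmt.tr, tr_wk, tr_inst] at hl ⊢
    exact tmEq_tru E (tm_wk_inst hl hp) hχ
  case m_or_beta2 _ _ hχ hp _ hr =>
    simp only [Stmt.tr, tr_wk, tr_inst] at hr ⊢
    exact tmEq_tru E (tm_wk_inst hr hp) hχ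
  case m_imp_intro hφ hψ hp =>
    simp only [Stmt.tr, tr_wk] at hp
    exact .imp_intro E hφ hψ (tru_intro E hp (ty_wk1 hψ hp.wf))
  case m_imp_elim hφ hψ hp hq =>
    exact .imp_elim E hφ hψ (tru_intro E hp (.imp_form .prop hφ hψ)) (tru_intro E hq hφ)
  case m_imp_beta _ hψ hp hq =>
    simp only [Stmt.tr, tr_wk, tr_inst] at hp ⊢
    exact tmEq_tru E (tm_wk_inst hp hq) hψ
  case m_all_intro hA hφ hp => exact .all_intro E hA hφ (tru_intro E hp hφ)
  case m_all_elim hA hφ hp ha =>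
    simp only [Stmt.tr, tr_inst]
    exact .all_elim E hA hφ (tru_intro E hp (.all_form .large hA hφ)) ha
  case m_all_beta _ hφ hp ha =>
    simp only [Stmt.tr, tr_inst]
    exact tmEq_tru E (tm_inst hp ha) (ty_inst hφ ha)
  case m_ex_intro hA hφ ha hp =>
    simp only [Stmt.tr, tr_inst] at hp
    exact .ex_intro E hA hφ ha (tru_intro E hp (ty_inst hφ ha))
  case m_ex_elim hA hφ hχ hp hm =>
    simp only [Stmt.tr, tr_wk] at hm
    exact .ex_elim E hA hφ hχ (tru_intro E hp (.ex_form .large hA hφ))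
      (tru_intro E hm (ty_wk2 hχ hm.wf))
  case m_ex_beta _ _ hχ ha hp hm =>
    simp only [Stmt.tr, tr_wk, tr_inst, tr_inst2] at hp hm ⊢
    exact tmEq_tru E (tm_wk_inst2 hm ha hp) hχ
  case Id_form hA ha hb => exact .Eq_form E ‹_› hA ha hb
  case Id_intro hA ha => exact .Eq_intro E hA ha
  case Id_elim hA hC ha hb hp hc =>
    simp only [Stmt.tr, trCtx_cons, tr_wk, tr_inst2, tr_instW2, tr] at hC hc ⊢
    exact tru_inst2_of_Eq E hA hC ha hb hp hc
  case Id_beta _ hC ha hc =>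
    simp only [Stmt.tr, trCtx_cons, tr_wk, tr_inst, tr_inst2, tr_instW2, tr] at hC hc ⊢
    exact tmEq_tru E (tm_diag_inst hc ha) (ty_inst2 hC ha ha)
  -- Only rules common to both theories remain. With the translation pushed inside instantiations
  -- and weakenings, each case is an instance of the rule of the same name.
  all_goals simp only [Stmt.tr, tr, tr_inst, tr_inst2, tr_inst3, tr_instW, tr_wk,
    tr_wkB, tr_subst, trCtx_cons] at *
  case ctx_nil => exact .ctx_nil
  case ctx_cons h => exact .ctx_cons h
  case var hA ih => exact .var ih (by simp [trCtx, hA])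
  case subT h₁ h₂ h₃ =>
    refine .subT h₁ h₂ fun i A hA => ?_
    obtain ⟨B, hB, rfl⟩ := trCtx_getElem? hA
    exact h₃ i B hB
  case sub h₁ h₂ h₃ =>
    refine .sub h₁ h₂ fun i A hA => ?_
    obtain ⟨B, hB, rfl⟩ := trCtx_getElem? hA
    exact h₃ i B hB
  case incl => apply incl <;> assumption
  case inclEq => apply inclEq <;> assumption
  case refT => exact .refT ‹_›
  case symT => exact .symT ‹_›
  case ref => exact .ref ‹_›
  case sym => exact .sym ‹_›
  case N0_form => exact .N0_form ‹_›
  case N0_elim => apply N0_elim <;> assumption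
  case N1_form => exact .N1_form ‹_›
  case N1_intro => exact .N1_intro ‹_›
  case N1_elim => apply N1_elim <;> assumption
  case N1_beta => apply N1_beta <;> assumption
  case Sigma_form => apply Sigma_form <;> assumption
  case Sigma_intro => apply Sigma_intro <;> assumption
  case Sigma_elim => apply Sigma_elim <;> assumption
  case Sigma_beta => apply Sigma_beta <;> assumption
  case Pi_form => apply Pi_form <;> assumption
  case Pi_intro => apply Pi_intro <;> assumption
  case Pi_elim => apply Pi_elim <;> assumption
  case Pi_beta => apply Pi_beta <;> assumption
  case Plus_form => apply Plus_form <;> assumption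
  case Plus_intro1 => apply Plus_intro1 <;> assumption
  case Plus_intro2 => apply Plus_intro2 <;> assumption
  case Plus_elim => apply Plus_elim <;> assumption
  case Plus_beta1 => apply Plus_beta1 <;> assumption
  case Plus_beta2 => apply Plus_beta2 <;> assumption
  case Lst_form => exact .Lst_form ‹_›
  case Lst_nil => exact .Lst_nil ‹_›
  case Lst_cons => apply Lst_cons <;> assumption
  case Lst_elim => apply Lst_elim <;> assumption
  case Lst_beta_nil => apply Lst_beta_nil <;> assumption
  case Lst_beta_cons => apply Lst_beta_cons <;> assumption
  case bot_form => exact .bot_form ‹_›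
  case and_form => apply and_form <;> assumption
  case or_form => apply or_form <;> assumption
  case imp_form => apply imp_form <;> assumption
  case all_form => apply all_form <;> assumption
  case ex_form => apply ex_form <;> assumption
  case traT h₁ h₂ => exact .traT h₁ h₂
  case tra h₁ h₂ => exact .tra h₁ h₂
  case conv h₁ h₂ => exact .conv h₁ h₂
  case convEq h₁ h₂ => exact .convEq h₁ h₂

end Der

end MF

/-- The translation `tr` is an interpretation of `mTT` into `emTT + propext`: it preserves the
derivability of all five forms of judgement. -/
theorem mainTheorem5 :
    (∀ Γ : MF.Ctx, MF.Der .mTT Γ .ctx →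
      MF.Der .emTTpropext (MF.trCtx Γ) .ctx) ∧
    (∀ (Γ : MF.Ctx) (k : MF.Kind) (A : MF.Exp .ty), MF.Der .mTT Γ (.ty k A) →
      MF.Der .emTTpropext (MF.trCtx Γ) (.ty k (MF.tr A))) ∧
    (∀ (Γ : MF.Ctx) (a : MF.Exp .tm) (A : MF.Exp .ty), MF.Der .mTT Γ (.tm a A) →
      MF.Der .emTTpropext (MF.trCtx Γ) (.tm (MF.tr a) (MF.tr A))) ∧
    (∀ (Γ : MF.Ctx) (k : MF.Kind) (A B : MF.Exp .ty), MF.Der .mTT Γ (.tyEq k A B) →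
      MF.Der .emTTpropext (MF.trCtx Γ) (.tyEq k (MF.tr A) (MF.tr B))) ∧
    (∀ (Γ : MF.Ctx) (a b : MF.Exp .tm) (A : MF.Exp .ty), MF.Der .mTT Γ (.tmEq a b A) →
      MF.Der .emTTpropext (MF.trCtx Γ) (.tmEq (MF.tr a) (MF.tr b) (MF.tr A))) :=
  ⟨fun _ h => h.tr_of_mTT, fun _ _ _ h => h.tr_of_mTT, fun _ _ _ h => h.tr_of_mTT,
    fun _ _ _ _ h => h.tr_of_mTT, fun _ _ _ _ h => h.tr_of_mTT⟩
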